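/- **Setting.** Let $n\ge 1$, let $\mathrm{Prob}$ be a probability measure on a measurable space $\mathbb Q$, let $\Theta\subset\mathbb R^n$ be convex and compact, $c\in\mathbb R^n$, and let $f:\mathbb R^n\times\mathbb Q\to\mathbb R$ be convex in its first argument and measurable in its second. Put $V(\theta)=\mathrm{Prob}\{q: f(\theta,q)>0\}$. For $m$ i.i.d. samples $\omega=(q^{(1)},\dots,q^{(m)})$ the scenario problem is $$\min_{\theta\in\Theta} c^\top\theta\quad\text{s.t. } f(\theta,q^{(i)})\le 0,\ i=1,\dots,m .$$ Its $j$-th constraint is a support constraint if removing it strictly lowers the optimal value; the problem with $m$ scenarios is fully supported w.p. 1 if almost surely it has exactly $n$ support constraints. Let $N\ge n$, $N_o\ge 0$ be integers and $\epsilon,\epsilon'\in[0,1]$. Assume that for every $m\ge N$ the scenario problem with $m$ i.i.d. scenarios is, with probability one, feasible with a unique optimal solution. One iteration of the repetitive scenario algorithm draws $N+N_o$ fresh i.i.d. samples (joint law $\mathrm{Prob}^{N+N_o}$), computes the solution $\theta^*$ of the scenario problem from the first $N$ samples, and calls the $\epsilon'$-randomized oracle, which returns $\mathtt{true}$ iff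 at most $\epsilon' N_o$ of the remaining $N_o$ samples $q$ satisfy $f(\theta^*,q)>0$. Let $\mathrm{True}$ be the event that the oracle returns $\mathtt{true}$, $\mathrm{GoodTrue}=\mathrm{True}\cap\{V(\theta^*)\le\epsilon\}$ and $\mathrm{BadTrue}=\mathrm{True}\cap\{V(\theta^*)>\epsilon\}$. **Notation.** $B(a,b)=\Gamma(a)\Gamma(b)/\Gamma(a+b)$, $\mathrm{Fbeta}(a,b;t)=\frac1{B(a,b)}\int_0^t u^{a-1}(1-u)^{b-1}\,du$ for $a,b>0$, and $$f_{bb}(i)=\binom{N_o}{i}\frac{B(i+n,\,N_o-i+N-n+1)}{B(n,\,N+1-n)},\qquad \beta_\epsilon(N)=1-\sum_{i=n}^{N}\binom Ni\epsilon^i(1-\epsilon)^{N-i},$$ $$H_{\epsilon,\epsilon'}=1-\sum_{i=0}^{\lfloor\epsilon'N_o\rfloor}f_{bb}(i)\,\mathrm{Fbeta}(n+i,\,N+N_o-n-i+1;\,\epsilon),\qquad H_{1,\epsilon'}=1-\sum_{i=0}^{\lfloor\epsilon'N_o\rfloor}f_{bb}(i),$$ $$\bar\beta_{\epsilon,\epsilon'}=\mathrm{Fbeta}(N+(1-\epsilon')N_o-n+1,\,n+\epsilon'N_o;\,1-\epsilon).$$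 **Lemma.** At any iteration: 1. $\mathrm{Prob}^{N+N_o}\{\mathrm{True}\}\ge 1-H_{1,\epsilon'}$; 2. $\mathrm{Prob}^{N+N_o}\{\mathrm{GoodTrue}\}\ge 1-H_{\epsilon,\epsilon'}\ge(1-\bar\beta_{\epsilon,\epsilon'})(1-H_{1,\epsilon'})$; 3. if $N_o\ge1$ and $\epsilon'<1$, then $\mathrm{Prob}^{N+N_o}\{\mathrm{BadTrue}\}\le\mathrm{Fbeta}((1-\epsilon')N_o,\,\epsilon'N_o+1;\,1-\epsilon)\,\beta_\epsilon(N)$. Moreover, if for every $m\ge N$ the scenario problem with $m$ scenarios is fully supported w.p. 1, then $\mathrm{Prob}^{N+N_o}\{\mathrm{True}\}=1-H_{1,\epsilon'}$, $\mathrm{Prob}^{N+N_o}\{\mathrm{GoodTrue}\}=1-H_{\epsilon,\epsilon'}$, and $$\mathrm{Prob}^{N+N_o}\{\mathrm{BadTrue}\}=H_{\epsilon,\epsilon'}-H_{1,\epsilon'}\le\bar\beta_{\epsilon,\epsilon'}(1-H_{1,\epsilon'}).$$ -/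

import Mathlib

open MeasureTheory

namespace RSD

noncomputable section

/-! ### Beta and beta-binomial quantities -/

/-- Cumulative distribution function of the beta density with parameters `a, b > 0`
(the regularized incomplete beta function), for `t` in `[0, 1]`. -/
def Fbeta (a b t : ℝ) : ℝ :=
  ∫ u in (0 : ℝ)..t, ProbabilityTheory.betaPDFReal a b u

/-- Beta-binomial probability mass function with `d` trials and parameters `a, b`. -/
def fbb (d : ℕ) (a b : ℝ) (i : ℕ) : ℝ :=
  (d.choose i : ℝ) *
    (ProbabilityTheory.beta ((i : ℝ) + a) ((d : ℝ) - (i : ℝ) + b) / ProbabilityTheory.beta a b)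

/-- `β_ε(N)`, defined by `1 - β_ε(N) = ∑_{i = n}^N C(N, i) ε^i (1 - ε)^(N - i)`. -/
def betaTail (n N : ℕ) (ε : ℝ) : ℝ :=
  1 - ∑ i ∈ Finset.Icc n N, (N.choose i : ℝ) * ε ^ i * (1 - ε) ^ (N - i)

/-- `H_{ε,ε'}(N, No)`. -/
def H (n N No : ℕ) (ε ε' : ℝ) : ℝ :=
  1 - ∑ i ∈ Finset.range (⌊ε' * (No : ℝ)⌋₊ + 1),
    fbb No (n : ℝ) ((N : ℝ) + 1 - (n : ℝ)) i *
      Fbeta ((n : ℝ) + (i : ℝ)) ((N : ℝ) + (No : ℝ) - (n : ℝ) - (i : ℝ) + 1) ε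

/-- `H_{1,ε'}(N, No)`, the upper tail of a beta-binomial distribution. -/
def H1 (n N No : ℕ) (ε' : ℝ) : ℝ :=
  1 - ∑ i ∈ Finset.range (⌊ε' * (No : ℝ)⌋₊ + 1),
    fbb No (n : ℝ) ((N : ℝ) + 1 - (n : ℝ)) i

/-- `β̄_{ε,ε'}(N, No)`. -/
def betaBar (n N No : ℕ) (ε ε' : ℝ) : ℝ :=
  Fbeta ((N : ℝ) + (1 - ε') * (No : ℝ) - (n : ℝ) + 1) ((n : ℝ) + ε' * (No : ℝ)) (1 - ε)

/-! ### Scenario problems -/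

variable {n : ℕ} {Q : Type*}

/-- Points of the domain `Θ` that satisfy the scenario constraints with index in `I`. -/
def feasibleSet (Θ : Set (Fin n → ℝ)) (f : (Fin n → ℝ) → Q → ℝ) {m : ℕ}
    (ω : Fin m → Q) (I : Set (Fin m)) : Set (Fin n → ℝ) :=
  {θ | θ ∈ Θ ∧ ∀ i ∈ I, f θ (ω i) ≤ 0}

/-- `θ` is an optimal solution of the scenario problem: minimize `cᵀθ` over `θ ∈ Θ` subject to
`f(θ, ω i) ≤ 0` for all `i`. -/
def IsOptimal (c : Fin n → ℝ) (Θ : Set (Fin n → ℝ)) (f : (Fin n → ℝ) → Q → ℝ) {m : ℕ}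
    (ω : Fin m → Q) (θ : Fin n → ℝ) : Prop :=
  θ ∈ feasibleSet Θ f ω Set.univ ∧ ∀ θ' ∈ feasibleSet Θ f ω Set.univ, c ⬝ᵥ θ ≤ c ⬝ᵥ θ'

open Classical in
/-- The solution `θ*(ω)` returned by the scenario step (and `0` if there is no optimal solution). -/
def scenarioSol (c : Fin n → ℝ) (Θ : Set (Fin n → ℝ)) (f : (Fin n → ℝ) → Q → ℝ) {m : ℕ}
    (ω : Fin m → Q) : Fin n → ℝ :=
  if h : ∃ θ, IsOptimal c Θ f ω θ then h.choose else 0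

/-- Optimal objective value when only the constraints with index in `I` are enforced. -/
def optValue (c : Fin n → ℝ) (Θ : Set (Fin n → ℝ)) (f : (Fin n → ℝ) → Q → ℝ) {m : ℕ}
    (ω : Fin m → Q) (I : Set (Fin m)) : ℝ :=
  sInf ((fun θ => c ⬝ᵥ θ) '' feasibleSet Θ f ω I)

/-- The `j`-th constraint is a support constraint: its removal lowers the optimal value. -/
def IsSupport (c : Fin n → ℝ) (Θ : Set (Fin n → ℝ)) (f : (Fin n → ℝ) → Q → ℝ) {m : ℕ}
    (ω : Fin m → Q) (j : Fin m) : Prop :=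
  optValue c Θ f ω {j}ᶜ < optValue c Θ f ω Set.univ

open Classical in
/-- The randomized `ε'`-violation oracle at `θ` on the test samples `ωo`: it returns `true` iff
the number of test samples violated by `θ` is at most `ε' * No`. -/
def rvo (f : (Fin n → ℝ) → Q → ℝ) (ε' : ℝ) {No : ℕ} (ωo : Fin No → Q) (θ : Fin n → ℝ) : Bool :=
  decide (∑ i, (if 0 < f θ (ωo i) then (1 : ℝ) else 0) ≤ ε' * (No : ℝ))

variable [MeasurableSpace Q]

/-- With probability one with respect to `m` i.i.d. scenarios, the scenario problem is feasible
and attains a unique optimal solution. -/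
def UniquelySolvable (P : Measure Q) (c : Fin n → ℝ) (Θ : Set (Fin n → ℝ))
    (f : (Fin n → ℝ) → Q → ℝ) (m : ℕ) : Prop :=
  ∀ᵐ ω ∂(Measure.pi fun _ : Fin m => P), ∃! θ, IsOptimal c Θ f ω θ

/-- With probability one with respect to `m` i.i.d. scenarios, the scenario problem has exactly
`n` support constraints, `n` being the number of decision variables. -/
def FullySupported (P : Measure Q) (c : Fin n → ℝ) (Θ : Set (Fin n → ℝ))
    (f : (Fin n → ℝ) → Q → ℝ) (m : ℕ) : Prop :=
  ∀ᵐ ω ∂(Measure.pi fun _ : Fin m => P), {j | IsSupport c Θ f ω j}.ncard = n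

/-- The probability of violation `V(θ) = Prob {q | f(θ, q) > 0}`. -/
def violation (P : Measure Q) (f : (Fin n → ℝ) → Q → ℝ) (θ : Fin n → ℝ) : ℝ :=
  P.real {q | 0 < f θ q}

/-! ### One iteration of the repetitive scenario algorithm -/

/-- The law `Prob^{N + No}` of the fresh samples drawn in an iteration: `N` design scenarios and
`No` oracle samples, all i.i.d. -/
def stageProb (P : Measure Q) (N No : ℕ) : Measure ((Fin N → Q) × (Fin No → Q)) :=
  (Measure.pi fun _ : Fin N => P).prod (Measure.pi fun _ : Fin No => P)

/-- The event that, in an iteration, the oracle returns `true` on the scenario solution. -/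
def TrueEvent (c : Fin n → ℝ) (Θ : Set (Fin n → ℝ)) (f : (Fin n → ℝ) → Q → ℝ)
    (N No : ℕ) (ε' : ℝ) : Set ((Fin N → Q) × (Fin No → Q)) :=
  {s | rvo f ε' s.2 (scenarioSol c Θ f s.1) = true}

/-- The oracle returns `true` and the scenario solution has violation probability `≤ ε`. -/
def GoodTrue (P : Measure Q) (c : Fin n → ℝ) (Θ : Set (Fin n → ℝ)) (f : (Fin n → ℝ) → Q → ℝ)
    (N No : ℕ) (ε ε' : ℝ) : Set ((Fin N → Q) × (Fin No → Q)) :=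
  TrueEvent c Θ f N No ε' ∩ {s | violation P f (scenarioSol c Θ f s.1) ≤ ε}

/-- The oracle returns `true` and the scenario solution has violation probability `> ε`. -/
def BadTrue (P : Measure Q) (c : Fin n → ℝ) (Θ : Set (Fin n → ℝ)) (f : (Fin n → ℝ) → Q → ℝ)
    (N No : ℕ) (ε ε' : ℝ) : Set ((Fin N → Q) × (Fin No → Q)) :=
  TrueEvent c Θ f N No ε' ∩ {s | ε < violation P f (scenarioSol c Θ f s.1)}

end

end RSD

/-! Given the design samples, the number of violated oracle samples is binomial with parameters `No`
and `V(θ*)`. By Fubini (`stageProb_trueEvent_inter`) every probability in the theorem is therefore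
an integral of `binomCDF` against the law of `V(θ*)`, and if that law were Beta(n, N+1-n) these
integrals would be the beta-binomial sums defining `H` and `H1`. `binomCDF` is decreasing on [0, 1],
so the bounds follow once `V(θ*)` is shown to be stochastically dominated by this beta law
(`violation_tail_le`).

Dominance is proved first for a perturbed ("heated") problem. Each scenario gets an independent
uniform label `z`, its constraint becomes `f θ q ≤ δ z`, and a small quadratic term makes the
objective strictly convex. Almost surely no scenario outside a subsample of size `n` is active at
the solution for that subsample, and Helly's theorem bounds the number of active constraints by `n`.
Padding the active set with the largest remaining labels gives exactly one compatible index set of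
size `n` (`existsUnique_compatible`). Hence, if `w` is the probability that a fresh scenario is
compatible with a random subsample of size `n`, then C(m,n) E[w^(m-n)] = 1 for all m ≥ N. These are
the moments of a beta law, which they determine (`compression_tail_le`). Compatibility excludes
violation, so the heated violation is at most `1 - w`. Letting δ → 0, heated solutions converge to
`θ*`, and lower semicontinuity passes the tail bound to the limit.

In the fully supported case, a leave-one-out count over N+1 samples gives E V(θ*) = n/(N+1), the
mean of the dominating beta law. Ordered laws with equal means coincide (`eq_of_dominance_of_mean`),
so the bounds become equalities. -/

open MeasureTheory

namespace RSD

open ProbabilityTheory Set Filter Topology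

/-! ### Beta distributions and the regularized incomplete beta function. -/

section Beta

lemma betaPDFReal_nonneg {a b : ℝ} (ha : 0 < a) (hb : 0 < b) (x : ℝ) : 0 ≤ betaPDFReal a b x := by
  by_cases hx : 0 < x ∧ x < 1
  · exact (betaPDFReal_pos hx.1 hx.2 ha hb).le
  · simp [betaPDFReal, hx]

lemma integrable_betaPDFReal {a b : ℝ} (ha : 0 < a) (hb : 0 < b) :
    Integrable (betaPDFReal a b) := by
  refine ⟨(stronglyMeasurable_betaPDFReal a b).aestronglyMeasurable, ?_⟩
  rw [hasFiniteIntegral_iff_ofReal (Filter.Eventually.of_forall (betaPDFReal_nonneg ha hb))]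
  have := lintegral_betaPDF_eq_one ha hb
  simp only [betaPDF] at this
  rw [this]; exact ENNReal.one_lt_top

lemma integral_betaPDFReal {a b : ℝ} (ha : 0 < a) (hb : 0 < b) : ∫ x, betaPDFReal a b x = 1 := by
  rw [integral_eq_lintegral_of_nonneg_ae (Filter.Eventually.of_forall (betaPDFReal_nonneg ha hb))
    (stronglyMeasurable_betaPDFReal a b).aestronglyMeasurable]
  have := lintegral_betaPDF_eq_one ha hb
  simp only [betaPDF] at this
  rw [this]; simp

lemma integral_betaMeasure {a b : ℝ} (ha : 0 < a) (hb : 0 < b) (g : ℝ → ℝ) :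
    ∫ x, g x ∂(betaMeasure a b) = ∫ x, betaPDFReal a b x * g x := by
  have h : betaPDF a b = fun x => ((betaPDFReal a b x).toNNReal : ENNReal) := rfl
  rw [betaMeasure, h, integral_withDensity_eq_integral_smul (by fun_prop)]
  congr 1; ext x
  simp [NNReal.smul_def, Real.coe_toNNReal _ (betaPDFReal_nonneg ha hb x)]

lemma betaMeasure_Iic {a b : ℝ} (ha : 0 < a) (hb : 0 < b) {t : ℝ} (ht : 0 ≤ t) :
    (betaMeasure a b).real (Iic t) = Fbeta a b t := by
  have h := integral_betaMeasure ha hb ((Iic t).indicator 1)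
  rw [integral_indicator_one measurableSet_Iic] at h
  rw [h, Fbeta, intervalIntegral.integral_of_le ht, ← integral_indicator measurableSet_Ioc]
  congr 1; ext x
  simp only [indicator, mem_Iic, mem_Ioc, Pi.one_apply]
  by_cases h0 : 0 < x
  · simp [h0]
  · simp [h0, betaPDFReal]

lemma Fbeta_one {a b : ℝ} (ha : 0 < a) (hb : 0 < b) : Fbeta a b 1 = 1 := by
  refine Eq.trans ?_ (integral_betaPDFReal ha hb)
  rw [Fbeta, intervalIntegral.integral_of_le zero_le_one, ← integral_indicator measurableSet_Ioc]
  congr 1; ext x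
  simp only [indicator, mem_Ioc]
  split_ifs with h
  · rfl
  · rw [betaPDFReal, if_neg (fun h' => h ⟨h'.1, h'.2.le⟩)]

lemma Fbeta_zero (a b : ℝ) : Fbeta a b 0 = 0 := by simp [Fbeta]

lemma Fbeta_mono {a b : ℝ} (ha : 0 < a) (hb : 0 < b) {s t : ℝ} (hs : 0 ≤ s) (hst : s ≤ t) :
    Fbeta a b s ≤ Fbeta a b t := by
  have := isProbabilityMeasureBeta ha hb
  rw [← betaMeasure_Iic ha hb hs, ← betaMeasure_Iic ha hb (hs.trans hst)]
  exact measureReal_mono (Iic_subset_Iic.2 hst)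

lemma Fbeta_nonneg {a b : ℝ} (ha : 0 < a) (hb : 0 < b) {t : ℝ} (ht : 0 ≤ t) :
    0 ≤ Fbeta a b t := by
  rw [← betaMeasure_Iic ha hb ht]; exact measureReal_nonneg

lemma beta_comm (a b : ℝ) : beta a b = beta b a := by
  simp only [beta, mul_comm, add_comm]

lemma betaPDFReal_one_sub (a b x : ℝ) : betaPDFReal a b (1 - x) = betaPDFReal b a x := by
  have : (0 < 1 - x ∧ 1 - x < 1) ↔ (0 < x ∧ x < 1) := by constructor <;> rintro ⟨_, _⟩ <;> constructor <;> linarith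
  simp only [betaPDFReal, this, beta_comm b a, sub_sub_cancel]
  split_ifs <;> ring

lemma one_sub_Fbeta {a b : ℝ} (ha : 0 < a) (hb : 0 < b) (t : ℝ) :
    1 - Fbeta a b t = ∫ u in t..1, betaPDFReal a b u := by
  have I := integrable_betaPDFReal ha hb
  rw [← intervalIntegral.integral_interval_sub_left (a := 0) I.intervalIntegrable
    I.intervalIntegrable]
  exact congrArg (· - Fbeta a b t) (Fbeta_one ha hb).symm

lemma Fbeta_one_sub {a b : ℝ} (ha : 0 < a) (hb : 0 < b) (t : ℝ) :
    Fbeta a b (1 - t) = 1 - Fbeta b a t := by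
  have h1 : Fbeta b a t = ∫ u in (1 - t)..1, betaPDFReal a b u := by
    have := intervalIntegral.integral_comp_sub_left (a := 0) (b := t) (betaPDFReal a b) 1
    simp only [betaPDFReal_one_sub, sub_zero] at this
    exact this
  rw [h1, ← one_sub_Fbeta ha hb, sub_sub_cancel]

/-- Conjugacy of the beta density with Bernoulli trials. Both the beta moments and the beta-binomial
integral rest on it. -/
lemma pow_mul_betaPDFReal {a b : ℝ} (ha : 0 < a) (hb : 0 < b) (i j : ℕ) (x : ℝ) :
    x ^ i * (1 - x) ^ j * betaPDFReal a b x =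
      beta (a + i) (b + j) / beta a b * betaPDFReal (a + i) (b + j) x := by
  rw [betaPDFReal, betaPDFReal]
  split_ifs with h
  · have h1 : 0 < 1 - x := by linarith
    rw [show a + i - 1 = (a - 1) + i by ring, show b + j - 1 = (b - 1) + j by ring,
      Real.rpow_add_natCast h.1.ne', Real.rpow_add_natCast h1.ne']
    have := (beta_pos (show 0 < a + i by positivity) (show 0 < b + j by positivity)).ne'
    field_simp
  · simp

/-- The ratio `w` of the two densities is increasing. Comparing it with `w t` on each side of `t`
bounds the two masses of one law by those of the other. -/
lemma Fbeta_param_mono {a b a' b' : ℝ} (ha : 0 < a) (hb : 0 < b') (haa : a ≤ a') (hbb : b' ≤ b)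
    {t : ℝ} (ht0 : 0 ≤ t) (ht1 : t ≤ 1) : Fbeta a' b' t ≤ Fbeta a b t := by
  rcases ht0.eq_or_lt with rfl | ht0
  · simp [Fbeta_zero]
  rcases ht1.eq_or_lt with rfl | ht1
  · rw [Fbeta_one ha (by linarith), Fbeta_one (by linarith) hb]
  have hb0 : 0 < b := by linarith
  have ha' : 0 < a' := by linarith
  have B1 := beta_pos ha hb0
  have B2 := beta_pos ha' hb
  set w : ℝ → ℝ := fun u => beta a b / beta a' b' * (u ^ (a' - a) * (1 - u) ^ (b' - b)) with hw
  have key : ∀ u, 0 < u → u < 1 → betaPDFReal a' b' u = w u * betaPDFReal a b u := by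
    intro u h0 h1
    rw [betaPDFReal, betaPDFReal, if_pos ⟨h0, h1⟩, if_pos ⟨h0, h1⟩, hw]
    have e1 : u ^ (a' - 1) = u ^ (a' - a) * u ^ (a - 1) := by
      rw [← Real.rpow_add h0]; congr 1; ring
    have e2 : (1 - u) ^ (b' - 1) = (1 - u) ^ (b' - b) * (1 - u) ^ (b - 1) := by
      rw [← Real.rpow_add (by linarith)]; congr 1; ring
    rw [e1, e2]; field_simp
  have wmono : ∀ u v, 0 < u → u ≤ v → v < 1 → w u ≤ w v := by
    intro u v h0 huv h1
    simp only [hw]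
    have := Real.rpow_le_rpow h0.le huv (by linarith : 0 ≤ a' - a)
    have h3 := Real.rpow_le_rpow_of_nonpos (by linarith : 0 < 1 - v) (by linarith : 1 - v ≤ 1 - u)
      (by linarith : b' - b ≤ 0)
    have : 0 ≤ (1 - u) ^ (b' - b) := Real.rpow_nonneg (by linarith) _
    have : 0 ≤ v ^ (a' - a) := Real.rpow_nonneg (by linarith) _
    gcongr
  have I1 := integrable_betaPDFReal ha hb0
  have I2 := integrable_betaPDFReal ha' hb
  have J1 : Fbeta a' b' t ≤ w t * Fbeta a b t := by
    rw [Fbeta, Fbeta, ← intervalIntegral.integral_const_mul]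
    refine intervalIntegral.integral_mono_on ht0.le I2.intervalIntegrable
      (I1.intervalIntegrable.const_mul _) fun u hu => ?_
    rcases hu.1.eq_or_lt with h | h
    · simp [betaPDFReal, ← h]
    · rw [key u h (by linarith [hu.2])]
      exact mul_le_mul_of_nonneg_right (wmono u t h hu.2 ht1) (betaPDFReal_nonneg ha hb0 u)
  have J2 : w t * (1 - Fbeta a b t) ≤ 1 - Fbeta a' b' t := by
    rw [one_sub_Fbeta ha hb0, one_sub_Fbeta ha' hb, ← intervalIntegral.integral_const_mul]
    refine intervalIntegral.integral_mono_on ht1.le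
      (I1.intervalIntegrable.const_mul _) I2.intervalIntegrable fun u hu => ?_
    rcases hu.2.eq_or_lt with h | h
    · simp [betaPDFReal, h]
    · rw [key u (by linarith [hu.1]) h]
      exact mul_le_mul_of_nonneg_right (wmono t u ht0 hu.1 h) (betaPDFReal_nonneg ha hb0 u)
  have K0 := Fbeta_nonneg ha hb0 ht0.le
  have K1 : Fbeta a b t ≤ 1 := by
    rw [← Fbeta_one ha hb0]; exact Fbeta_mono ha hb0 ht0.le ht1.le
  -- With F and F' the two values, `J1` and `J2` give F'(1-F) ≤ w(t) F(1-F) ≤ F(1-F'), hence F' ≤ F.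
  nlinarith [mul_le_mul_of_nonneg_right J1 (sub_nonneg.2 K1), mul_le_mul_of_nonneg_right J2 K0]

lemma beta_nat (j l : ℕ) :
    beta ((j : ℝ) + 1) ((l : ℝ) + 1) = (j.factorial * l.factorial : ℝ) / (j + l + 1).factorial := by
  rw [beta, Real.Gamma_nat_eq_factorial, Real.Gamma_nat_eq_factorial,
    ← Real.Gamma_nat_eq_factorial (j + l + 1)]
  push_cast; congr 2; ring

lemma Fbeta_nat (j l : ℕ) {t : ℝ} (h0 : 0 ≤ t) (h1 : t ≤ 1) :
    Fbeta ((j : ℝ) + 1) ((l : ℝ) + 1) t =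
      ∫ u in (0 : ℝ)..t, ((j + l + 1).factorial : ℝ) / (j.factorial * l.factorial)
        * u ^ j * (1 - u) ^ l := by
  rw [Fbeta, intervalIntegral.integral_of_le h0, intervalIntegral.integral_of_le h0,
    integral_Ioc_eq_integral_Ioo, integral_Ioc_eq_integral_Ioo]
  refine setIntegral_congr_fun measurableSet_Ioo fun u hu => ?_
  simp only [betaPDFReal]
  rw [if_pos ⟨hu.1, by linarith [hu.2]⟩, beta_nat, one_div_div]
  simp

/-- Binomial upper tails are values of the regularized incomplete beta function. -/
lemma sum_binomial_eq_Fbeta (l j : ℕ) {t : ℝ} (h0 : 0 ≤ t) (h1 : t ≤ 1) :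
    ∑ i ∈ Finset.Icc (j + 1) (j + l + 1),
      ((j + l + 1).choose i : ℝ) * t ^ i * (1 - t) ^ (j + l + 1 - i) =
      Fbeta ((j : ℝ) + 1) ((l : ℝ) + 1) t := by
  induction l generalizing j with
  | zero =>
    rw [Fbeta_nat j 0 h0 h1]
    simp only [add_zero, Finset.Icc_self, Finset.sum_singleton, Nat.choose_self, Nat.factorial_succ,
      Nat.sub_self, pow_zero, Nat.factorial_zero]
    rw [show (fun u : ℝ => (((j + 1) * j.factorial : ℕ) : ℝ) / (j.factorial * (1 : ℕ)) * u ^ j * 1)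
      = fun u => ((j : ℝ) + 1) * u ^ j by
        ext u; have : (j.factorial : ℝ) ≠ 0 := by positivity
        push_cast; field_simp]
    rw [intervalIntegral.integral_const_mul, integral_pow]
    have : (j : ℝ) + 1 ≠ 0 := by positivity
    field_simp; simp
  | succ l ih =>
    have step := ih (j + 1)
    rw [show j + (l + 1) + 1 = (j + 1) + l + 1 by ring,
      ← Finset.add_sum_Ioc_eq_sum_Icc (by omega), ← Finset.Icc_add_one_left_eq_Ioc, step,
      Fbeta_nat (j + 1) l h0 h1, Fbeta_nat j (l + 1) h0 h1, ← eq_sub_iff_add_eq,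
      ← intervalIntegral.integral_sub (by apply Continuous.intervalIntegrable; fun_prop)
        (by apply Continuous.intervalIntegrable; fun_prop)]
    -- The lowest term of the binomial sum is a primitive of the difference of the two beta
    -- densities and vanishes at 0.
    have hd : ∀ u ∈ uIcc 0 t, HasDerivAt
        (fun u : ℝ => ((j + 1 + l + 1).choose (j + 1) : ℝ) * u ^ (j + 1) * (1 - u) ^ (l + 1))
        (((j + (l + 1) + 1).factorial : ℝ) / (j.factorial * (l + 1).factorial) * u ^ j
            * (1 - u) ^ (l + 1) -
          ((j + 1 + l + 1).factorial : ℝ) / ((j + 1).factorial * l.factorial) * u ^ (j + 1)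
            * (1 - u) ^ l) u := by
      intro u _
      have d1 := (hasDerivAt_pow (j + 1) u).const_mul ((j + 1 + l + 1).choose (j + 1) : ℝ)
      have d2 := ((hasDerivAt_id u).const_sub 1).fun_pow (l + 1)
      convert! d1.mul d2 using 1
      rw [Nat.cast_choose ℝ (by omega), show j + 1 + l + 1 - (j + 1) = l + 1 by omega,
        show j + (l + 1) + 1 = j + 1 + l + 1 by ring]
      simp only [Nat.factorial_succ, Nat.cast_mul, Nat.cast_add, Nat.cast_one, id,
        Nat.add_sub_cancel]
      have : (j.factorial : ℝ) ≠ 0 := by positivity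
      have : (l.factorial : ℝ) ≠ 0 := by positivity
      field_simp
      ring
    rw [intervalIntegral.integral_eq_sub_of_hasDerivAt hd
      (by apply Continuous.intervalIntegrable; fun_prop)]
    simp [show j + 1 + l + 1 - (j + 1) = l + 1 by omega]

lemma sum_binomial_Icc {a M : ℕ} (ha : 1 ≤ a) (haM : a ≤ M) {t : ℝ} (h0 : 0 ≤ t) (h1 : t ≤ 1) :
    ∑ i ∈ Finset.Icc a M, (M.choose i : ℝ) * t ^ i * (1 - t) ^ (M - i) =
      Fbeta a ((M : ℝ) + 1 - a) t := by
  obtain ⟨j, rfl⟩ := Nat.exists_eq_add_of_le ha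
  obtain ⟨l, rfl⟩ := Nat.exists_eq_add_of_le haM
  have := sum_binomial_eq_Fbeta l j h0 h1
  rw [show 1 + j = j + 1 by ring, show j + 1 + l = j + l + 1 by ring, this]
  push_cast; congr 1; ring

lemma integral_pow_betaMeasure {a b : ℝ} (ha : 0 < a) (hb : 0 < b) (j : ℕ) :
    ∫ x, x ^ j ∂(betaMeasure a b) = beta (a + j) b / beta a b := by
  rw [integral_betaMeasure ha hb]
  have : ∀ x, betaPDFReal a b x * x ^ j = beta (a + j) b / beta a b * betaPDFReal (a + j) b x := by
    intro x
    have := pow_mul_betaPDFReal ha hb j 0 x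
    simp at this
    rw [← this]; ring
  simp_rw [this]
  rw [integral_const_mul, integral_betaPDFReal (by positivity) hb, mul_one]

lemma betaMeasure_ae_mem_Icc (a b : ℝ) : ∀ᵐ x ∂(betaMeasure a b), x ∈ Icc (0 : ℝ) 1 := by
  rw [betaMeasure, ae_withDensity_iff (show Measurable (betaPDF a b) by unfold betaPDF; fun_prop)]
  refine Filter.Eventually.of_forall fun x hx => ?_
  by_contra h
  refine hx ?_
  rw [betaPDF, betaPDFReal, if_neg fun h' => h ⟨h'.1.le, h'.2.le⟩, ENNReal.ofReal_zero]

end Beta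

/-! ### Stochastic order, and identification of laws on [0, 1]. -/

section Dominance

/-- A nonempty proper lower set of ℝ is `Iic c` or `Iio c`, and the latter is an increasing union of
sets `Iic`. -/
lemma measure_isLowerSet_le {ρ κ : Measure ℝ} [IsProbabilityMeasure ρ] [IsProbabilityMeasure κ]
    (h : ∀ t, κ (Iic t) ≤ ρ (Iic t)) {D : Set ℝ} (hD : IsLowerSet D) : κ D ≤ ρ D := by
  rcases D.eq_empty_or_nonempty with rfl | hne
  · simp
  by_cases hb : BddAbove D
  swap
  · have : D = univ := by
      refine eq_univ_of_forall fun x => ?_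
      obtain ⟨y, hy, hxy⟩ := not_bddAbove_iff.1 hb x
      exact hD hxy.le hy
    simp [this]
  set c := sSup D
  have h1 : Iio c ⊆ D := fun x hx => by
    obtain ⟨y, hy, hxy⟩ := exists_lt_of_lt_csSup hne hx
    exact hD hxy.le hy
  have h2 : D ⊆ Iic c := fun x hx => le_csSup hb hx
  by_cases hc : c ∈ D
  · have : D = Iic c := h2.antisymm fun x hx => hD hx hc
    rw [this]; exact h c
  · have : D = Iio c := Subset.antisymm
      (fun x hx => lt_of_le_of_ne (h2 hx) (fun e : x = c => hc (e ▸ hx))) h1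
    rw [this]
    obtain ⟨u, hu, hlt, hlim⟩ := exists_seq_strictMono_tendsto c
    rw [← iUnion_Iic_eq_Iio_of_lt_of_tendsto hlt hlim,
      Monotone.measure_iUnion (fun i j hij => Iic_subset_Iic.2 (hu.monotone hij)),
      Monotone.measure_iUnion (fun i j hij => Iic_subset_Iic.2 (hu.monotone hij))]
    exact iSup_mono fun i => h _

/-- Layer-cake formula: the superlevel sets of an antitone function are lower sets. -/
lemma integral_antitone_le {ρ κ : Measure ℝ} [IsProbabilityMeasure ρ] [IsProbabilityMeasure κ]
    (h : ∀ t, κ (Iic t) ≤ ρ (Iic t)) {g : ℝ → ℝ} (hg : Antitone g) {K : ℝ}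
    (h0 : ∀ x, 0 ≤ g x) (hK : ∀ x, g x ≤ K) : ∫ x, g x ∂κ ≤ ∫ x, g x ∂ρ := by
  have hI : ∀ (τ : Measure ℝ) [IsProbabilityMeasure τ], Integrable g τ := fun τ _ =>
    Integrable.of_bound hg.measurable.aestronglyMeasurable K
      (Filter.Eventually.of_forall fun x => by rw [Real.norm_of_nonneg (h0 x)]; exact hK x)
  have key : ∫⁻ x, ENNReal.ofReal (g x) ∂κ ≤ ∫⁻ x, ENNReal.ofReal (g x) ∂ρ := by
    rw [lintegral_eq_lintegral_meas_lt _ (Filter.Eventually.of_forall h0) hg.measurable.aemeasurable,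
      lintegral_eq_lintegral_meas_lt _ (Filter.Eventually.of_forall h0) hg.measurable.aemeasurable]
    exact lintegral_mono fun t => measure_isLowerSet_le h fun x y hxy hx => lt_of_lt_of_le hx (hg hxy)
  rw [← ofReal_integral_eq_lintegral_ofReal (hI κ) (Filter.Eventually.of_forall h0),
    ← ofReal_integral_eq_lintegral_ofReal (hI ρ) (Filter.Eventually.of_forall h0)] at key
  exact (ENNReal.ofReal_le_ofReal_iff (integral_nonneg h0)).1 key

/-- Stochastically ordered laws on `[0, 1]` with the same mean coincide. -/
lemma eq_of_dominance_of_mean {ρ κ : Measure ℝ} [IsProbabilityMeasure ρ] [IsProbabilityMeasure κ]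
    (hρ : ∀ᵐ x ∂ρ, x ∈ Icc (0 : ℝ) 1) (hκ : ∀ᵐ x ∂κ, x ∈ Icc (0 : ℝ) 1)
    (h : ∀ t, κ (Iic t) ≤ ρ (Iic t)) (hm : ∫ x, x ∂κ = ∫ x, x ∂ρ) : ρ = κ := by
  have hI : ∀ (τ : Measure ℝ) [IsProbabilityMeasure τ], (∀ᵐ x ∂τ, x ∈ Icc (0 : ℝ) 1) →
      Integrable (fun x => x) τ := fun τ _ hτ =>
    Integrable.of_bound aestronglyMeasurable_id 1
      (hτ.mono fun x hx => by rw [Real.norm_of_nonneg hx.1]; exact hx.2)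
  have hlay : ∀ (τ : Measure ℝ) [IsProbabilityMeasure τ], (∀ᵐ x ∂τ, x ∈ Icc (0 : ℝ) 1) →
      ∫⁻ t in Ioi 0, τ (Ioi t) = ENNReal.ofReal (∫ x, x ∂τ) := by
    intro τ _ hτ
    rw [ofReal_integral_eq_lintegral_ofReal (hI τ hτ) (hτ.mono fun x hx => hx.1),
      lintegral_eq_lintegral_meas_lt _ (hτ.mono fun x hx => hx.1) measurable_id.aemeasurable]
    rfl
  have hcompl : ∀ t, ρ (Ioi t) ≤ κ (Ioi t) := by
    intro t
    rw [← compl_Iic, prob_compl_eq_one_sub measurableSet_Iic, prob_compl_eq_one_sub measurableSet_Iic]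
    exact tsub_le_tsub_left (h t) _
  have meas : ∀ (τ : Measure ℝ), Measurable fun t => τ (Ioi t) := fun τ =>
    Antitone.measurable fun s t hst => measure_mono (Ioi_subset_Ioi hst)
  -- The tails are ordered and have equal finite integrals, namely the means, so they agree almost
  -- everywhere.
  have hae : ∀ᵐ t ∂(volume.restrict (Ioi (0 : ℝ))), ρ (Ioi t) = κ (Ioi t) := by
    refine ae_eq_of_ae_le_of_lintegral_le (Filter.Eventually.of_forall hcompl) ?_
      (meas κ).aemeasurable ?_
    · rw [hlay ρ hρ]; exact ENNReal.ofReal_ne_top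
    · rw [hlay ρ hρ, hlay κ hκ, hm]
  rw [ae_restrict_iff' measurableSet_Ioi] at hae
  have hIoi : ∀ t, 0 ≤ t → κ (Ioi t) ≤ ρ (Ioi t) := by
    intro t ht
    -- Points of agreement accumulate at `t` from the right, and tails are right-continuous.
    have hdense : ∀ s, t < s → ∃ r, t < r ∧ r < s ∧ ρ (Ioi r) = κ (Ioi r) := by
      intro s hs
      by_contra! hcon
      have hsub : Ioo t s ⊆ {r | ¬ (r ∈ Ioi (0 : ℝ) → ρ (Ioi r) = κ (Ioi r))} := fun r hr hr' =>
        hcon r hr.1 hr.2 (hr' (ht.trans_lt hr.1))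
      have := measure_mono_null hsub (ae_iff.1 hae)
      simp at this; linarith
    obtain ⟨u, hu, hlt, hlim⟩ := exists_seq_strictAnti_tendsto t
    have hcov : Ioi t = ⋃ i, Ioi (u i) := Subset.antisymm
      (fun x hx => mem_iUnion.2 (hlim.eventually_lt_const hx).exists)
      (iUnion_subset fun i => Ioi_subset_Ioi (hlt i).le)
    rw [hcov, Monotone.measure_iUnion (fun i j hij => Ioi_subset_Ioi (hu.antitone hij))]
    refine iSup_le fun i => ?_
    obtain ⟨r, h1, h2, h3⟩ := hdense (u i) (hlt i)
    calc κ (Ioi (u i)) ≤ κ (Ioi r) := measure_mono (Ioi_subset_Ioi h2.le)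
      _ = ρ (Ioi r) := h3.symm
      _ ≤ _ := measure_mono (hcov ▸ Ioi_subset_Ioi h1.le)
  refine Measure.ext_of_Iic _ _ fun t => le_antisymm ?_ (h t)
  rcases lt_or_ge t 0 with ht | ht
  · have : ρ (Iic t) = 0 := by
      refine measure_mono_null (fun x (hx : x ≤ t) => ?_) (ae_iff.1 hρ)
      exact fun hx' : x ∈ Icc (0 : ℝ) 1 => by linarith [hx'.1]
    rw [this]; exact zero_le
  · rw [← compl_Ioi, prob_compl_eq_one_sub measurableSet_Ioi, prob_compl_eq_one_sub measurableSet_Ioi]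
    exact tsub_le_tsub_left (hIoi t ht) _

/-- A law on `[0, 1]` is determined by its moments. -/
lemma eq_of_moments {ρ κ : Measure ℝ} [IsProbabilityMeasure ρ] [IsProbabilityMeasure κ]
    (hρ : ∀ᵐ x ∂ρ, x ∈ Icc (0 : ℝ) 1) (hκ : ∀ᵐ x ∂κ, x ∈ Icc (0 : ℝ) 1)
    (hm : ∀ j : ℕ, ∫ x, x ^ j ∂ρ = ∫ x, x ^ j ∂κ) : ρ = κ := by
  have hpoly : ∀ p : Polynomial ℝ, ∫ x, p.eval x ∂ρ = ∫ x, p.eval x ∂κ := by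
    have hI : ∀ (τ : Measure ℝ) [IsProbabilityMeasure τ], (∀ᵐ x ∂τ, x ∈ Icc (0 : ℝ) 1) →
      ∀ j : ℕ, Integrable (fun x => x ^ j) τ := fun τ _ hτ j =>
      Integrable.of_bound (by fun_prop) 1
      (hτ.mono fun x hx => by rw [Real.norm_of_nonneg (pow_nonneg hx.1 _)]; exact pow_le_one₀ hx.1 hx.2)
    intro p
    simp_rw [Polynomial.eval_eq_sum_range]
    rw [integral_finsetSum _ fun i _ => (hI ρ hρ i).const_mul _,
      integral_finsetSum _ fun i _ => (hI κ hκ i).const_mul _]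
    simp_rw [integral_const_mul, hm]
  refine ext_of_forall_integral_eq_of_IsFiniteMeasure fun φ => ?_
  have hIφ : ∀ (τ : Measure ℝ) [IsProbabilityMeasure τ], Integrable φ τ := fun τ _ => φ.integrable τ
  refine eq_of_forall_dist_le fun e he => ?_
  obtain ⟨p, hp⟩ := exists_polynomial_near_of_continuousOn 0 1 φ φ.continuous.continuousOn (e / 2)
    (by positivity)
  have hb : ∀ (τ : Measure ℝ) [IsProbabilityMeasure τ], (∀ᵐ x ∂τ, x ∈ Icc (0 : ℝ) 1) →
      dist (∫ x, φ x ∂τ) (∫ x, p.eval x ∂τ) ≤ e / 2 := by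
    intro τ _ hτ
    have hIp : Integrable (fun x => p.eval x) τ := by
      obtain ⟨K, hK⟩ := isCompact_Icc.exists_bound_of_continuousOn (s := Icc (0 : ℝ) 1)
        p.continuous.continuousOn
      exact Integrable.of_bound (by fun_prop) K (hτ.mono fun x hx => hK x hx)
    rw [dist_eq_norm, ← integral_sub (hIφ τ) hIp]
    have := norm_integral_le_of_norm_le_const (μ := τ) (f := fun x => φ x - p.eval x) (C := e / 2)
      (hτ.mono fun x hx => by rw [norm_sub_rev]; exact (hp x hx).le)
    simpa using this
  calc _ ≤ dist (∫ x, φ x ∂ρ) (∫ x, p.eval x ∂ρ) + dist (∫ x, p.eval x ∂κ) (∫ x, φ x ∂κ) := by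
        rw [hpoly p]; exact dist_triangle _ _ _
    _ ≤ e / 2 + e / 2 := add_le_add (hb ρ hρ) (by rw [dist_comm]; exact hb κ hκ)
    _ = e := by ring

end Dominance

/-! ### Exact compression schemes of size `n`. -/

section Compression

variable {X : Type*} [MeasurableSpace X]

/-- The points of `x` with index in `I`, in increasing order of the indices. -/
def subsample {m n : ℕ} (I : Finset (Fin m)) (hI : I.card = n) (x : Fin m → X) : Fin n → X :=
  fun i => x (I.orderEmbOfFin hI i)

/-- Every point of `x` with index outside of `I` is related to the subsample with index in `I`. -/
def Compatible {n : ℕ} (R : (Fin n → X) → X → Prop) {m : ℕ} (x : Fin m → X) (I : Finset (Fin m)) :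
    Prop :=
  ∃ hI : I.card = n, ∀ j ∉ I, R (subsample I hI x) (x j)

lemma measurable_subsample {m n : ℕ} (I : Finset (Fin m)) (hI : I.card = n) :
    Measurable (subsample (X := X) I hI) :=
  measurable_pi_lambda _ fun _ => measurable_pi_apply _

lemma measurePreserving_reindex (μ : Measure X) [IsProbabilityMeasure μ] {ι κ : Type*} [Fintype ι]
    [Fintype κ] (e : ι ≃ κ) :
    MeasurePreserving (fun (x : κ → X) (i : ι) => x (e i)) (Measure.pi fun _ => μ)
      (Measure.pi fun _ => μ) := by
  convert! measurePreserving_piCongrLeft (α := fun _ : ι => X) (fun _ => μ) e.symm using 1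
  ext x i
  obtain ⟨k, rfl⟩ := e.symm.surjective i
  rw [MeasurableEquiv.coe_piCongrLeft, Equiv.piCongrLeft_apply_apply]
  simp

/-- The coordinates inside and outside `I` are independent. With the subsample `y` fixed, each of
the `m - n` others is related to `y` with the same probability. -/
lemma measure_subsample_event (μ : Measure X) [IsProbabilityMeasure μ] {n m : ℕ}
    {R : (Fin n → X) → X → Prop} (hR : MeasurableSet {p : (Fin n → X) × X | R p.1 p.2})
    (I : Finset (Fin m)) (hI : I.card = n) {S : Set (Fin n → X)} (hS : MeasurableSet S) :
    Measure.pi (fun _ => μ) {x | (∀ j ∉ I, R (subsample I hI x) (x j)) ∧ subsample I hI x ∈ S} =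
      ∫⁻ y in S, (μ {x | R y x}) ^ (m - n) ∂(Measure.pi fun _ => μ) := by
  have hIc : Iᶜ.card = m - n := by rw [Finset.card_compl, hI, Fintype.card_fin]
  set e := finSumEquivOfFinset hI hIc
  have mp := (measurePreserving_sumPiEquivProdPi (X := fun _ : Fin n ⊕ Fin (m - n) => X)
    (fun _ => μ)).comp (measurePreserving_reindex μ e)
  set W : Set ((Fin n → X) × (Fin (m - n) → X)) := {p | (∀ j, R p.1 (p.2 j)) ∧ p.1 ∈ S}
  have hW : MeasurableSet W := by
    refine MeasurableSet.inter ?_ (measurable_fst hS)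
    have : {p : (Fin n → X) × (Fin (m - n) → X) | ∀ j, R p.1 (p.2 j)} =
      ⋂ j, (fun p => (p.1, p.2 j)) ⁻¹' {p | R p.1 p.2} := by ext; simp
    change MeasurableSet {p : (Fin n → X) × (Fin (m - n) → X) | ∀ j, R p.1 (p.2 j)}
    rw [this]
    exact MeasurableSet.iInter fun j => (by fun_prop : Measurable _) hR
  have hset : {x : Fin m → X | (∀ j ∉ I, R (subsample I hI x) (x j)) ∧ subsample I hI x ∈ S} =
      (MeasurableEquiv.sumPiEquivProdPi (fun _ : Fin n ⊕ Fin (m - n) => X) ∘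
        fun (x : Fin m → X) i => x (e i)) ⁻¹' W := by
    ext x
    change _ ↔ (∀ j : Fin (m - n), R (subsample I hI x) (x (Iᶜ.orderEmbOfFin hIc j))) ∧ _
    refine and_congr ⟨fun h j => h _ ?_, fun h j hj => ?_⟩ Iff.rfl
    · exact Finset.mem_compl.1 (Finset.orderEmbOfFin_mem _ _ _)
    · have : j ∈ Set.range (Iᶜ.orderEmbOfFin hIc) := by
        rw [Finset.range_orderEmbOfFin]; simpa using hj
      obtain ⟨k, rfl⟩ := this
      exact h k
  rw [hset, mp.measure_preimage hW.nullMeasurableSet, Measure.prod_apply hW,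
    ← lintegral_indicator hS]
  congr 1; ext y
  by_cases hy : y ∈ S
  · have : Prod.mk y ⁻¹' W = Set.pi univ fun _ => {x | R y x} := by
      ext z; simp [W, hy]
    simp [hy, this, Measure.pi_pi]
  · have : Prod.mk y ⁻¹' W = ∅ := by ext z; simp [W, hy]
    simp [hy, this]

/-- The indicators of compatibility sum to 1 almost surely, and all C(m,n) index sets of size `n`
contribute the same integral. -/
lemma lintegral_compression (μ : Measure X) [IsProbabilityMeasure μ] {n m : ℕ}
    {R : (Fin n → X) → X → Prop} (hR : MeasurableSet {p : (Fin n → X) × X | R p.1 p.2})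
    (hex : ∀ᵐ x ∂(Measure.pi fun _ : Fin m => μ), ∃! I, Compatible R x I) :
    (m.choose n : ENNReal) * ∫⁻ y, (μ {x | R y x}) ^ (m - n) ∂(Measure.pi fun _ : Fin n => μ) = 1 := by
  classical
  set ν := Measure.pi fun _ : Fin m => μ
  have hmeas : ∀ I : Finset (Fin m), MeasurableSet {x : Fin m → X | Compatible R x I} := by
    intro I
    by_cases hI : I.card = n
    · have : {x : Fin m → X | Compatible R x I} =
        ⋂ j, ⋂ (_ : j ∉ I), (fun x => (subsample I hI x, x j)) ⁻¹' {p | R p.1 p.2} := by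
        ext x; simp [Compatible, hI]
      rw [this]
      exact MeasurableSet.iInter fun j => MeasurableSet.iInter fun _ =>
        ((measurable_subsample I hI).prodMk (measurable_pi_apply j)) hR
    · simp [Compatible, hI]
  have h1 : ∫⁻ x, ∑ I : Finset (Fin m), {x : Fin m → X | Compatible R x I}.indicator 1 x ∂ν = 1 := by
    rw [lintegral_congr_ae (g := fun _ => 1)]
    · simp [ν]
    · filter_upwards [hex] with x ⟨I, hI, huniq⟩
      rw [Finset.sum_eq_single I]
      · simp [hI]
      · intro J _ hJ
        exact indicator_of_notMem (s := {x : Fin m → X | Compatible R x J}) (fun h => hJ (huniq J h)) _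
      · simp
  rw [lintegral_finsetSum _ fun I _ => measurable_one.indicator (hmeas I)] at h1
  simp_rw [lintegral_indicator_one (hmeas _)] at h1
  rw [← Finset.sum_subset (Finset.subset_univ (Finset.univ.powersetCard n)),
    Finset.sum_congr rfl (g := fun _ => ∫⁻ y, (μ {x | R y x}) ^ (m - n) ∂(Measure.pi fun _ : Fin n => μ))] at h1
  · simpa using h1
  · intro I hI
    have hI := (Finset.mem_powersetCard.1 hI).2
    have := measure_subsample_event μ hR I hI MeasurableSet.univ
    rw [Measure.restrict_univ] at this
    rw [← this]
    congr 1; ext x; simp [Compatible, hI]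
  · intro I _ hI
    have : I.card ≠ n := fun h => hI (Finset.mem_powersetCard.2 ⟨Finset.subset_univ _, h⟩)
    simp [Compatible, this]

/-- The `j`-th moment of Beta(N+1-n, n) is C(N,n)/C(N+j,n), the value that the compression identity
at `m = N + j` dictates. -/
lemma beta_choose {n N : ℕ} (hn : 1 ≤ n) (hN : n ≤ N) (j : ℕ) :
    (((N + j).choose n : ℝ)) * (beta ((N : ℝ) + 1 - n + j) n / beta ((N : ℝ) + 1 - n) n) =
      (N.choose n : ℝ) := by
  obtain ⟨p, rfl⟩ := Nat.exists_eq_add_of_le' hn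
  obtain ⟨l, rfl⟩ := Nat.exists_eq_add_of_le hN
  have h1 := beta_nat (l + j) p
  have h2 := beta_nat l p
  rw [show ((p + 1 + l : ℕ) : ℝ) + 1 - ((p + 1 : ℕ) : ℝ) + j = ((l + j : ℕ) : ℝ) + 1 by push_cast; ring,
    show ((p + 1 + l : ℕ) : ℝ) + 1 - ((p + 1 : ℕ) : ℝ) = (l : ℝ) + 1 by push_cast; ring,
    show ((p + 1 : ℕ) : ℝ) = (p : ℝ) + 1 by push_cast; ring, h1, h2,
    Nat.cast_choose ℝ (by omega), Nat.cast_choose ℝ (by omega),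
    show p + 1 + l + j - (p + 1) = l + j by omega, show p + 1 + l - (p + 1) = l by omega,
    show p + 1 + l + j = l + j + p + 1 by ring, show p + 1 + l = l + p + 1 by ring]
  have : ((l + j).factorial : ℝ) ≠ 0 := by positivity
  have : ((l + j + p + 1).factorial : ℝ) ≠ 0 := by positivity
  have : ((l + p + 1).factorial : ℝ) ≠ 0 := by positivity
  have : ((p).factorial : ℝ) ≠ 0 := by positivity
  have : ((l).factorial : ℝ) ≠ 0 := by positivity
  field_simp

/-- Law of the probability of incompatibility of an exact compression scheme of size `n`. -/
lemma compression_tail_le (μ : Measure X) [IsProbabilityMeasure μ] {n N : ℕ} (hn : 1 ≤ n)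
    (hN : n ≤ N) {R : (Fin n → X) → X → Prop}
    (hR : MeasurableSet {p : (Fin n → X) × X | R p.1 p.2})
    (hex : ∀ m, N ≤ m → ∀ᵐ x ∂(Measure.pi fun _ : Fin m => μ), ∃! I, Compatible R x I) (t : ℝ) :
    Measure.pi (fun _ : Fin N => μ)
      {x | ∃ I, ∃ hI : I.card = n, (∀ j ∉ I, R (subsample I hI x) (x j)) ∧
        μ.real {z | R (subsample I hI x) z} < t} ≤
      betaMeasure ((N : ℝ) + 1 - n) n (Iio t) := by
  classical
  set ν := Measure.pi fun _ : Fin n => μ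
  set w : (Fin n → X) → ℝ := fun y => μ.real {z | R y z} with hw
  have hwm : Measurable w := (measurable_measure_prodMk_left hR).ennreal_toReal
  have hwE : ∀ y, μ {z | R y z} = ENNReal.ofReal (w y) := fun y => by
    rw [hw]; simp [Measure.real]
  have hw0 : ∀ y, 0 ≤ w y := fun y => measureReal_nonneg
  have hw1 : ∀ y, w y ≤ 1 := fun y => measureReal_le_one
  have ha : (0 : ℝ) < (N : ℝ) + 1 - n := by
    have : (n : ℝ) ≤ N := by exact_mod_cast hN
    linarith
  have hb : (0 : ℝ) < n := by exact_mod_cast hn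
  have hprob := isProbabilityMeasureBeta ha hb
  -- Density of mass 1, by the compression identity at `m = N`. Under it, the identity at `m = N +
  -- j` becomes the `j`-th moment of `w`.
  set D : (Fin n → X) → ENNReal := fun y => ENNReal.ofReal ((N.choose n : ℝ) * w y ^ (N - n))
  have hD : Measurable D := by fun_prop
  have hpow : ∀ m, N ≤ m → (m.choose n : ℝ) * ∫ y, w y ^ (m - n) ∂ν = 1 := by
    intro m hm
    have := lintegral_compression μ hR (hex m hm)
    simp_rw [hwE, ← ENNReal.ofReal_pow (hw0 _)] at this
    rw [← ofReal_integral_eq_lintegral_ofReal] at this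
    · have := congrArg ENNReal.toReal this
      rw [ENNReal.toReal_mul, ENNReal.toReal_ofReal (integral_nonneg fun y => pow_nonneg (hw0 y) _)]
        at this
      simpa using this
    · exact Integrable.of_bound (by fun_prop) 1 (Filter.Eventually.of_forall fun y => by
        rw [Real.norm_of_nonneg (pow_nonneg (hw0 y) _)]; exact pow_le_one₀ (hw0 y) (hw1 y))
    · exact Filter.Eventually.of_forall fun y => pow_nonneg (hw0 y) _
  have hint : ∀ g : (Fin n → X) → ℝ, ∫ y, g y ∂(ν.withDensity D) =
      (N.choose n : ℝ) * ∫ y, w y ^ (N - n) * g y ∂ν := by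
    intro g
    have h : D = fun y => ((((N.choose n : ℝ) * w y ^ (N - n)).toNNReal : NNReal) : ENNReal) := rfl
    rw [h, integral_withDensity_eq_integral_smul (by fun_prop), ← integral_const_mul]
    congr 1; ext y
    have := hw0 y
    rw [NNReal.smul_def, Real.coe_toNNReal _ (by positivity), smul_eq_mul, mul_assoc]
  have hfin : IsProbabilityMeasure (ν.withDensity D) := by
    refine ⟨?_⟩
    have := lintegral_compression μ hR (hex N le_rfl)
    rw [withDensity_apply _ MeasurableSet.univ, Measure.restrict_univ, ← this,
      ← lintegral_const_mul _ (by simp_rw [hwE]; fun_prop)]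
    congr 1; ext y
    simp only [D]
    rw [ENNReal.ofReal_mul (by positivity), hwE, ENNReal.ofReal_pow (hw0 y)]
    simp
  have hρp : IsProbabilityMeasure ((ν.withDensity D).map w) :=
    Measure.isProbabilityMeasure_map hwm.aemeasurable
  have hlaw : (ν.withDensity D).map w = betaMeasure ((N : ℝ) + 1 - n) n := by
    refine eq_of_moments ?_ ?_ fun j => ?_
    · refine (ae_map_iff hwm.aemeasurable measurableSet_Icc).2 ?_
      exact Filter.Eventually.of_forall fun y => ⟨hw0 y, hw1 y⟩
    · exact betaMeasure_ae_mem_Icc _ _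
    · rw [integral_map hwm.aemeasurable (by fun_prop), hint, integral_pow_betaMeasure ha hb]
      have h1 := hpow (N + j) (by omega)
      have h2 := beta_choose hn hN j
      have h3 : (((N + j).choose n : ℕ) : ℝ) ≠ 0 := by
        have := Nat.choose_pos (show n ≤ N + j by omega)
        positivity
      simp_rw [← pow_add]
      rw [show N - n + j = N + j - n by omega]
      rw [← h2, mul_right_comm, h1, one_mul]
  have hStm : MeasurableSet {y | w y < t} := measurableSet_lt hwm measurable_const
  -- A union bound over `I` suffices: its C(N,n) equal terms add up to the tilted measure of `{w <
  -- t}`.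
  calc _ ≤ Measure.pi (fun _ : Fin N => μ) (⋃ I ∈ Finset.univ.powersetCard n,
        {x | ∃ hI : I.card = n, (∀ j ∉ I, R (subsample I hI x) (x j)) ∧
          subsample I hI x ∈ {y | w y < t}}) := by
        refine measure_mono fun x ⟨I, hI, h⟩ => ?_
        simp only [mem_iUnion]
        exact ⟨I, Finset.mem_powersetCard.2 ⟨Finset.subset_univ _, hI⟩, hI, h⟩
    _ ≤ ∑ I ∈ Finset.univ.powersetCard n, ∫⁻ y in {y | w y < t}, (μ {x | R y x}) ^ (N - n) ∂ν := by
        refine (measure_biUnion_finset_le _ _).trans (Finset.sum_le_sum fun I hI => ?_)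
        have hI := (Finset.mem_powersetCard.1 hI).2
        rw [← measure_subsample_event μ hR I hI hStm]
        exact measure_mono fun x ⟨_, h⟩ => h
    _ = (ν.withDensity D) {y | w y < t} := by
        rw [withDensity_apply _ hStm, Finset.sum_const, Finset.card_powersetCard, Finset.card_univ,
          Fintype.card_fin, nsmul_eq_mul, ← lintegral_const_mul _ (by simp_rw [hwE]; fun_prop)]
        congr 1; ext y
        simp only [D]
        rw [ENNReal.ofReal_mul (by positivity), hwE, ENNReal.ofReal_pow (hw0 y)]
        simp
    _ = _ := by rw [← hlaw, Measure.map_apply hwm measurableSet_Iio]; rfl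

end Compression

/-! ### Measurability of minimizers. -/

section Selection

/-- By compactness a solution in `C` exists as soon as solutions with slack `1/(k+1)` exist for
every `k`. With slack, a countable dense set is enough to search. -/
lemma measurableSet_exists_le {E Y ι : Type*} [MetricSpace E] [MeasurableSpace Y] [Finite ι]
    {C : Set E} (hC : IsCompact C) {g : ι → E → Y → ℝ} (hc : ∀ i y, Continuous fun θ => g i θ y)
    (hm : ∀ i θ, Measurable (g i θ)) : MeasurableSet {y | ∃ θ ∈ C, ∀ i, g i θ y ≤ 0} := by
  obtain ⟨D, hDC, hDc, hCD⟩ := hC.isSeparable.exists_countable_dense_subset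
  have : {y | ∃ θ ∈ C, ∀ i, g i θ y ≤ 0} =
      ⋂ k : ℕ, ⋃ d ∈ D, ⋂ i, {y | g i d y < 1 / ((k : ℝ) + 1)} := by
    ext y
    simp only [mem_ofPred_eq, mem_iInter, mem_iUnion, exists_prop]
    constructor
    · rintro ⟨θ, hθ, h⟩ k
      have ho : IsOpen {θ | ∀ i, g i θ y < 1 / ((k : ℝ) + 1)} := by
        simp only [ofPred_forall]
        exact isOpen_iInter_of_finite fun i => isOpen_lt (hc i y) continuous_const
      obtain ⟨d, hd, hdD⟩ := mem_closure_iff.1 (hCD hθ) _ ho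
        (fun i => (h i).trans_lt (by positivity))
      exact ⟨d, hdD, hd⟩
    · intro h
      choose d hdD hd using h
      obtain ⟨θ, hθ, φ, hφ, hlim⟩ := hC.tendsto_subseq fun k => hDC (hdD k)
      refine ⟨θ, hθ, fun i => ?_⟩
      refine le_of_tendsto_of_tendsto (((hc i y).tendsto θ).comp hlim)
        (tendsto_one_div_add_atTop_nhds_zero_nat.comp hφ.tendsto_atTop)
        (Eventually.of_forall fun k => (hd (φ k) i).le)
  rw [this]
  exact MeasurableSet.iInter fun k => MeasurableSet.biUnion hDc fun d _ =>
    MeasurableSet.iInter fun i => measurableSet_lt (hm i d) measurable_const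

/-- A unique minimizer under random constraints depends measurably on the constraints. -/
lemma measurable_argmin {E Y ι : Type*} [MetricSpace E] [MeasurableSpace E] [BorelSpace E]
    [MeasurableSpace Y] [Finite ι] {Θ : Set E} (hΘ : IsCompact Θ) {h : E → ℝ} (hh : Continuous h)
    {g : ι → E → Y → ℝ} (hc : ∀ i y, Continuous fun θ => g i θ y)
    (hm : ∀ i θ, Measurable (g i θ)) {S : Set Y} (hS : MeasurableSet S) {s : Y → E} (e : E)
    (hs : ∀ y ∈ S, (s y ∈ Θ ∧ ∀ i, g i (s y) y ≤ 0) ∧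
      ∀ θ ∈ Θ, (∀ i, g i θ y ≤ 0) → h (s y) ≤ h θ ∧ (h θ ≤ h (s y) → θ = s y))
    (hs' : ∀ y ∉ S, s y = e) : Measurable s := by
  refine measurable_of_isClosed fun C hC => ?_
  set L : Set E → ℚ → Set Y := fun K r => {y | ∃ θ ∈ K ∩ {θ | h θ ≤ r}, ∀ i, g i θ y ≤ 0}
  have hL : ∀ K r, IsCompact K → MeasurableSet (L K r) := fun K r hK =>
    measurableSet_exists_le (hK.inter_right (isClosed_le hh continuous_const)) hc hm
  -- The unique minimizer lies in `C` iff restricting to `C` does not raise the minimum, which is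
  -- tested at rational levels.
  have key : s ⁻¹' C = (S ∩ ⋂ r, ((L Θ r)ᶜ ∪ L (Θ ∩ C) r)) ∪ (Sᶜ ∩ {_y | e ∈ C}) := by
    ext y
    by_cases hy : y ∈ S
    swap
    · simp [hy, hs' y hy]
    obtain ⟨⟨h1, h2⟩, h3⟩ := hs y hy
    simp only [mem_preimage, mem_union, mem_inter_iff, hy, mem_iInter, mem_compl_iff,
      true_and, not_true_eq_false, false_and, or_false]
    constructor
    · intro hsC r
      refine or_iff_not_imp_left.2 fun hr => ?_
      obtain ⟨θ, ⟨hθ, hθr⟩, hθg⟩ := not_not.1 hr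
      exact ⟨s y, ⟨⟨h1, hsC⟩, ((h3 θ hθ hθg).1.trans hθr)⟩, h2⟩
    · intro hall
      have hk : ∀ k : ℕ, ∃ θ ∈ Θ ∩ C, h θ ≤ h (s y) + 1 / ((k : ℝ) + 1) ∧ ∀ i, g i θ y ≤ 0 := by
        intro k
        obtain ⟨r, hr1, hr2⟩ := exists_rat_btwn
          (show h (s y) < h (s y) + 1 / ((k : ℝ) + 1) by linarith [show 0 < 1 / ((k : ℝ) + 1) by positivity])
        rcases hall r with hr | ⟨θ, ⟨hθ, hθr⟩, hθg⟩
        · exact absurd ⟨s y, ⟨h1, hr1.le⟩, h2⟩ hr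
        · exact ⟨θ, hθ, (show h θ ≤ r from hθr).trans hr2.le, hθg⟩
      choose θ hθ hθr hθg using hk
      obtain ⟨p, hp, φ, hφ, hlim⟩ := (hΘ.inter_right hC).tendsto_subseq hθ
      have hpg : ∀ i, g i p y ≤ 0 := fun i => le_of_tendsto (((hc i y).tendsto p).comp hlim)
        (Eventually.of_forall fun k => hθg (φ k) i)
      have hph : h p ≤ h (s y) := by
        have hr : Tendsto (fun k => h (s y) + 1 / ((φ k : ℝ) + 1)) atTop (𝓝 (h (s y) + 0)) :=
          (tendsto_one_div_add_atTop_nhds_zero_nat.comp hφ.tendsto_atTop).const_add (h (s y))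
        rw [add_zero] at hr
        exact le_of_tendsto_of_tendsto ((hh.tendsto p).comp hlim) hr
          (Eventually.of_forall fun k => hθr (φ k))
      rw [← (h3 p hp.1 hpg).2 hph]
      exact hp.2
  rw [key]
  exact (hS.inter (MeasurableSet.iInter fun r => (hL _ r hΘ).compl.union
    (hL _ r (hΘ.inter_right hC)))).union (hS.compl.inter (MeasurableSet.const _))

end Selection

/-! ### Convex programs with fixed scenarios: Helly bases, active sets, uniqueness of the compressed
set. -/

section Deterministic

variable {n : ℕ} {X : Type*}

lemma feasibleSet_subsample (Θ : Set (Fin n → ℝ)) (g : (Fin n → ℝ) → X → ℝ) {m k : ℕ}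
    (x : Fin m → X) (I : Finset (Fin m)) (hI : I.card = k) :
    feasibleSet Θ g (subsample I hI x) univ = feasibleSet Θ g x I := by
  ext θ
  simp only [feasibleSet, subsample, mem_ofPred_eq, mem_univ, true_imp_iff]
  refine and_congr_right fun _ => ⟨fun h j hj => ?_, fun h i => h _ (I.orderEmbOfFin_mem hI i)⟩
  have : j ∈ Set.range (I.orderEmbOfFin hI) := by rw [Finset.range_orderEmbOfFin]; exact hj
  obtain ⟨i, rfl⟩ := this
  exact h i

lemma feasibleSet_anti (Θ : Set (Fin n → ℝ)) (g : (Fin n → ℝ) → X → ℝ) {m : ℕ}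
    (x : Fin m → X) {I J : Set (Fin m)} (hIJ : I ⊆ J) :
    feasibleSet Θ g x J ⊆ feasibleSet Θ g x I :=
  fun _ h => ⟨h.1, fun i hi => h.2 i (hIJ hi)⟩

lemma convex_feasibleSet {Θ : Set (Fin n → ℝ)} (hΘ : Convex ℝ Θ) {g : (Fin n → ℝ) → X → ℝ}
    (hg : ∀ a, ConvexOn ℝ univ fun θ => g θ a) {m : ℕ} (x : Fin m → X) (I : Set (Fin m)) :
    Convex ℝ (feasibleSet Θ g x I) := by
  have : feasibleSet Θ g x I = Θ ∩ ⋂ i ∈ I, {θ | θ ∈ univ ∧ g θ (x i) ≤ 0} := by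
    ext; simp [feasibleSet]
  rw [this]
  exact hΘ.inter (convex_iInter₂ fun i _ => (hg (x i)).convex_le 0)

lemma isCompact_feasibleSet {Θ : Set (Fin n → ℝ)} (hΘ : IsCompact Θ) {g : (Fin n → ℝ) → X → ℝ}
    (hg : ∀ a, Continuous fun θ => g θ a) {m : ℕ} (x : Fin m → X) (I : Set (Fin m)) :
    IsCompact (feasibleSet Θ g x I) := by
  have : feasibleSet Θ g x I = Θ ∩ ⋂ i ∈ I, {θ | g θ (x i) ≤ 0} := by
    ext; simp [feasibleSet]
  rw [this]
  exact hΘ.inter_right (isClosed_biInter fun i _ => isClosed_le (hg _) continuous_const)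

/-- At most `n` constraints determine the optimal value of a convex program in `n` variables. -/
lemma exists_basis {Θ : Set (Fin n → ℝ)} (hΘ : Convex ℝ Θ)
    {g : (Fin n → ℝ) → X → ℝ} (hg : ∀ a, ConvexOn ℝ univ fun θ => g θ a)
    {h : (Fin n → ℝ) → ℝ} (hh : ConvexOn ℝ univ h) {m : ℕ} (hm : n ≤ m) (x : Fin m → X)
    {θ : Fin n → ℝ} (hθ : θ ∈ feasibleSet Θ g x univ) (hmin : IsMinOn h (feasibleSet Θ g x univ) θ) :
    ∃ T : Finset (Fin m), T.card = n ∧ IsMinOn h (feasibleSet Θ g x T) θ := by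
  classical
  -- Helly is applied to the single-constraint sets together with the strict sublevel set of `h` at
  -- `θ`. If no `T` works, any `n + 1` of them meet, so all meet, against minimality.
  set F : Option (Fin m) → Set (Fin n → ℝ) := fun o =>
    o.elim {θ' | θ' ∈ univ ∧ h θ' < h θ} fun j => feasibleSet Θ g x {j} with hF
  by_contra! hcon
  have := Convex.helly_theorem (𝕜 := ℝ) (F := F) (s := Finset.univ) (by simpa using hm) ?_ ?_
  · obtain ⟨p, hp⟩ := this
    simp only [mem_iInter] at hp
    have h1 : h p < h θ := (hp none (Finset.mem_univ _)).2
    have h2 : ∀ j, p ∈ feasibleSet Θ g x {j} := fun j => hp (some j) (Finset.mem_univ _)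
    by_cases hne : Nonempty (Fin m)
    · have : p ∈ feasibleSet Θ g x univ := ⟨(h2 hne.some).1, fun j _ => (h2 j).2 j rfl⟩
      exact absurd (hmin this) (not_le.2 h1)
    -- With no scenario the common point need not lie in `Θ`, but then the space is a single point.
    · have hn : n = 0 := by
        have : m = 0 := by
          by_contra h0; exact hne ⟨⟨0, Nat.pos_of_ne_zero h0⟩⟩
        omega
      subst hn
      have : p = θ := Subsingleton.elim _ _
      exact absurd h1 (by rw [this]; exact lt_irrefl _)
  · rintro (_ | j) _
    · exact hh.convex_lt _
    · exact convex_feasibleSet hΘ hg x _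
  · intro I _ hI
    by_cases hnone : none ∈ I
    · have hcard : I.eraseNone.card = n := by
        have := Finset.card_eraseNone_of_mem hnone
        rw [this, hI]; simp
      have := hcon _ hcard
      simp only [isMinOn_iff, not_forall, not_le] at this
      obtain ⟨p, hp, hlt⟩ := this
      refine ⟨p, mem_iInter₂.2 fun o ho => ?_⟩
      rcases o with _ | j
      · exact ⟨mem_univ _, hlt⟩
      · exact ⟨hp.1, fun i hi => hp.2 i (by rw [mem_singleton_iff.1 hi]; simpa using ho)⟩
    · refine ⟨θ, mem_iInter₂.2 fun o ho => ?_⟩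
      rcases o with _ | j
      · exact absurd ho hnone
      · exact ⟨hθ.1, fun i _ => hθ.2 i (mem_univ _)⟩

/-- The constraints that are active at a minimizer already make it a minimizer. -/
lemma isMinOn_active {Θ : Set (Fin n → ℝ)} (hΘ : Convex ℝ Θ)
    {g : (Fin n → ℝ) → X → ℝ} (hg : ∀ a, ConvexOn ℝ univ fun θ => g θ a)
    (hgc : ∀ a, Continuous fun θ => g θ a)
    {h : (Fin n → ℝ) → ℝ} (hh : ConvexOn ℝ univ h) {m : ℕ} (x : Fin m → X)
    {θ : Fin n → ℝ} (hθ : θ ∈ feasibleSet Θ g x univ) (hmin : IsMinOn h (feasibleSet Θ g x univ) θ) :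
    IsMinOn h (feasibleSet Θ g x {j | g θ (x j) = 0}) θ := by
  refine isMinOn_iff.2 fun p hp => ?_
  by_contra! hlt
  have hcont : Continuous fun s : ℝ => (1 - s) • θ + s • p := by fun_prop
  -- A short move from `θ` towards a better point keeps active constraints by convexity and inactive
  -- ones by continuity.
  have hev : ∀ j, ∀ᶠ s in 𝓝[>] (0 : ℝ), g ((1 - s) • θ + s • p) (x j) ≤ 0 := by
    intro j
    by_cases hj : g θ (x j) = 0
    · filter_upwards [Ioo_mem_nhdsGT (zero_lt_one' ℝ)] with s hs
      have := (hg (x j)).2 (mem_univ θ) (mem_univ p) (by linarith [hs.2] : 0 ≤ 1 - s) hs.1.le (by ring)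
      simp only [smul_eq_mul] at this
      nlinarith [hp.2 j hj, hs.1]
    · have hneg : g θ (x j) < 0 := lt_of_le_of_ne (hθ.2 j (mem_univ _)) hj
      have ht : Tendsto (fun s : ℝ => g ((1 - s) • θ + s • p) (x j)) (𝓝 0) (𝓝 (g θ (x j))) := by
        have := ((hgc (x j)).comp hcont).tendsto 0
        simpa [Function.comp_def] using this
      exact nhdsWithin_le_nhds ((ht.eventually_lt_const hneg).mono fun s hs => hs.le)
  obtain ⟨s, hs, hs0, hs1⟩ := ((eventually_all.2 hev).and (Ioo_mem_nhdsGT (zero_lt_one' ℝ))).exists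
  have hfeas : (1 - s) • θ + s • p ∈ feasibleSet Θ g x univ :=
    ⟨hΘ hθ.1 hp.1 (by linarith) hs0.le (by ring), fun j _ => hs j⟩
  have h1 := isMinOn_iff.1 hmin _ hfeas
  have h2 := hh.2 (mem_univ θ) (mem_univ p) (by linarith : 0 ≤ 1 - s) hs0.le (by ring)
  simp only [smul_eq_mul] at h2
  nlinarith

lemma exists_top_subset {α : Type*} [DecidableEq α] (z : α → ℝ) (hz : Function.Injective z)
    (B : Finset α) (k : ℕ) (hk : k ≤ B.card) :
    ∃ U ⊆ B, U.card = k ∧ ∀ i ∈ U, ∀ j ∈ B, j ∉ U → z j < z i := by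
  induction k with
  | zero => exact ⟨∅, by simp, by simp, by simp⟩
  | succ k ih =>
    obtain ⟨U, hU, hUk, htop⟩ := ih (by omega)
    have hne : (B \ U).Nonempty := by
      rw [← Finset.card_pos, Finset.card_sdiff_of_subset hU]; omega
    obtain ⟨b, hb, hmax⟩ := Finset.exists_max_image (B \ U) z hne
    rw [Finset.mem_sdiff] at hb
    refine ⟨insert b U, Finset.insert_subset hb.1 hU, by rw [Finset.card_insert_of_notMem hb.2, hUk],
      fun i hi j hj hjU => ?_⟩
    rw [Finset.mem_insert, not_or] at hjU
    rcases Finset.mem_insert.1 hi with rfl | hi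
    · exact lt_of_le_of_ne (hmax j (Finset.mem_sdiff.2 ⟨hj, hjU.2⟩)) fun e => hjU.1 (hz e)
    · exact htop i hi j hj hjU.2

/-- A scenario `a` leaves the solution `sol y` and its padding unchanged. -/
def Keeps (g : (Fin n → ℝ) → X → ℝ) (z : X → ℝ) (sol : (Fin n → X) → Fin n → ℝ)
    (y : Fin n → X) (a : X) : Prop :=
  g (sol y) a ≤ 0 ∧ ∀ i, g (sol y) (y i) ≠ 0 → z a < z (y i)

/-- The compatible set is the active set `A` plus the `n - |A|` other indices with the largest
labels. Any compatible set has solution `θ`, hence contains `A` by `hgen`, and the label condition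
in `Keeps` fixes the rest. -/
lemma existsUnique_compatible {Θ : Set (Fin n → ℝ)} (hΘ : Convex ℝ Θ)
    {g : (Fin n → ℝ) → X → ℝ} (hg : ∀ a, ConvexOn ℝ univ fun θ => g θ a)
    (hgc : ∀ a, Continuous fun θ => g θ a)
    {h : (Fin n → ℝ) → ℝ} (hh : StrictConvexOn ℝ univ h) {m : ℕ} (hm : n ≤ m)
    (z : X → ℝ) {sol : (Fin n → X) → Fin n → ℝ}
    (hsol : ∀ y, (feasibleSet Θ g y univ).Nonempty →
      sol y ∈ feasibleSet Θ g y univ ∧ IsMinOn h (feasibleSet Θ g y univ) (sol y))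
    (x : Fin m → X) (hz : Function.Injective fun i => z (x i))
    (hgen : ∀ I : Finset (Fin m), ∀ hI : I.card = n, ∀ j ∉ I, g (sol (subsample I hI x)) (x j) ≠ 0)
    {θ : Fin n → ℝ} (hθ : θ ∈ feasibleSet Θ g x univ)
    (hmin : IsMinOn h (feasibleSet Θ g x univ) θ) :
    (∃! I, Compatible (Keeps g z sol) x I) ∧
      ∀ I, ∀ hI : I.card = n, Compatible (Keeps g z sol) x I → sol (subsample I hI x) = θ := by
  classical
  have huniq : ∀ I : Set (Fin m), ∀ p q, p ∈ feasibleSet Θ g x I → IsMinOn h (feasibleSet Θ g x I) p →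
      q ∈ feasibleSet Θ g x I → IsMinOn h (feasibleSet Θ g x I) q → p = q := fun I p q hp hp' hq hq' =>
    (hh.subset (subset_univ _) (convex_feasibleSet hΘ hg x I)).eq_of_isMinOn hp' hq' hp hq
  have hfeasI : ∀ I : Set (Fin m), θ ∈ feasibleSet Θ g x I := fun I =>
    feasibleSet_anti Θ g x (subset_univ I) hθ
  have hsolI : ∀ I : Finset (Fin m), ∀ hI : I.card = n,
      sol (subsample I hI x) ∈ feasibleSet Θ g x I ∧
        IsMinOn h (feasibleSet Θ g x I) (sol (subsample I hI x)) := by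
    intro I hI
    have := hsol (subsample I hI x)
    rw [feasibleSet_subsample] at this
    exact this ⟨θ, hfeasI I⟩
  have hcompat : ∀ I, ∀ hI : I.card = n, Compatible (Keeps g z sol) x I →
      sol (subsample I hI x) = θ := by
    rintro I hI ⟨_, hc⟩
    obtain ⟨h1, h2⟩ := hsolI I hI
    have hall : sol (subsample I hI x) ∈ feasibleSet Θ g x univ := by
      refine ⟨h1.1, fun j _ => ?_⟩
      by_cases hj : j ∈ I
      · exact h1.2 j hj
      · exact (hc j hj).1
    exact huniq univ _ _ hall (h2.on_subset (feasibleSet_anti Θ g x (subset_univ _))) hθ hmin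
  refine ⟨?_, hcompat⟩
  set A : Finset (Fin m) := Finset.univ.filter fun j => g θ (x j) = 0 with hA
  have hAmin : IsMinOn h (feasibleSet Θ g x A) θ := by
    have := isMinOn_active hΘ hg hgc hh.convexOn x hθ hmin
    rw [hA]; simpa using this
  have hAsub : ∀ I : Finset (Fin m), ∀ hI : I.card = n, sol (subsample I hI x) = θ → A ⊆ I := by
    intro I hI he j hj
    by_contra hjI
    exact hgen I hI j hjI (by rw [he]; exact (Finset.mem_filter.1 hj).2)
  obtain ⟨T, hT, hTmin⟩ := exists_basis hΘ hg hh.convexOn hm x hθ hmin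
  -- A Helly basis has solution `θ` too, so it contains `A`; this is what bounds `|A|` by `n`.
  have hAT : A ⊆ T := hAsub T hT
    (huniq T _ _ (hsolI T hT).1 (hsolI T hT).2 (hfeasI T) hTmin)
  have hAn : A.card ≤ n := hT ▸ Finset.card_le_card hAT
  obtain ⟨U, hU, hUk, htop⟩ := exists_top_subset (fun i => z (x i)) hz Aᶜ (n - A.card)
    (by rw [Finset.card_compl, Fintype.card_fin]; omega)
  have hdisj : Disjoint A U := Finset.disjoint_left.2 fun a ha haU => by
    simpa [ha] using hU haU
  have hIcard : (A ∪ U).card = n := by rw [Finset.card_union_of_disjoint hdisj, hUk]; omega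
  have hsolAU : sol (subsample (A ∪ U) hIcard x) = θ :=
    huniq _ _ _ (hsolI _ hIcard).1 (hsolI _ hIcard).2 (hfeasI _)
      (hAmin.on_subset (feasibleSet_anti Θ g x (by simp)))
  refine ⟨A ∪ U, ⟨hIcard, fun j hj => ⟨?_, fun i hi => ?_⟩⟩, fun J hJ => ?_⟩
  · rw [hsolAU]; exact hθ.2 j (mem_univ _)
  · rw [hsolAU] at hi
    have hmem := (A ∪ U).orderEmbOfFin_mem hIcard i
    rw [Finset.mem_union, not_or] at hj
    rcases Finset.mem_union.1 hmem with hm' | hm'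
    · exact absurd (Finset.mem_filter.1 hm').2 hi
    · exact htop _ hm' j (Finset.mem_compl.2 hj.1) hj.2
  · obtain ⟨hJn, hJ'⟩ := hJ
    have hJθ := hcompat J hJn ⟨hJn, hJ'⟩
    have hAJ := hAsub J hJn hJθ
    by_contra hne
    have hJ1 : ∃ i ∈ J, i ∉ A ∪ U := by
      by_contra! hsub
      exact hne (Finset.eq_of_subset_of_card_le hsub (by rw [hIcard, hJn]))
    have hJ2 : ∃ j ∈ A ∪ U, j ∉ J := by
      by_contra! hsub
      exact hne (Finset.eq_of_subset_of_card_le hsub (by rw [hIcard, hJn])).symm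
    obtain ⟨i, hiJ, hi⟩ := hJ1
    obtain ⟨j, hj, hjJ⟩ := hJ2
    rw [Finset.mem_union, not_or] at hi
    have hjU : j ∈ U := (Finset.mem_union.1 hj).resolve_left fun h => hjJ (hAJ h)
    -- The choice of `U` puts the label of `i` below that of `j`; compatibility of `J` says the
    -- opposite.
    have h1 := htop j hjU i (Finset.mem_compl.2 hi.1) hi.2
    obtain ⟨k, hk⟩ : i ∈ Set.range (J.orderEmbOfFin hJn) := by
      rw [Finset.range_orderEmbOfFin]; exact hiJ
    have h2 := (hJ' j hjJ).2 k (by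
      rw [hJθ]; simp only [subsample, hk]
      exact fun h0 => hi.1 (Finset.mem_filter.2 ⟨Finset.mem_univ _, h0⟩))
    simp only [subsample, hk] at h2
    exact lt_asymm h1 h2

end Deterministic

/-! ### Random relaxation that makes the scenario problem nondegenerate. -/

section Heating

variable {n : ℕ} {Q : Type*}

/-- The relaxation of the constraint `f θ q ≤ 0` to `f θ q ≤ δ z`. -/
def heated (f : (Fin n → ℝ) → Q → ℝ) (δ : ℝ) (θ : Fin n → ℝ) (a : Q × ℝ) : ℝ := f θ a.1 - δ * a.2

/-- The linear objective with a small strictly convex term added. -/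
def heatedObj (c : Fin n → ℝ) (δ : ℝ) (θ : Fin n → ℝ) : ℝ := c ⬝ᵥ θ + δ * (θ ⬝ᵥ θ)

lemma continuous_dotProduct_const (c : Fin n → ℝ) : Continuous fun θ : Fin n → ℝ => c ⬝ᵥ θ := by
  unfold dotProduct; fun_prop

lemma continuous_heatedObj (c : Fin n → ℝ) (δ : ℝ) : Continuous (heatedObj c δ) := by
  unfold heatedObj dotProduct; fun_prop

lemma strictConvexOn_heatedObj (c : Fin n → ℝ) {δ : ℝ} (hδ : 0 < δ) :
    StrictConvexOn ℝ univ (heatedObj c δ) := by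
  refine ⟨convex_univ, fun x _ y _ hxy a b ha hb hab => ?_⟩
  have hpos : 0 < (x - y) ⬝ᵥ (x - y) := by
    have hne : x - y ≠ 0 := sub_ne_zero.2 hxy
    obtain ⟨i, hi⟩ := Function.ne_iff.1 hne
    exact Finset.sum_pos' (fun i _ => mul_self_nonneg _) ⟨i, Finset.mem_univ _, mul_self_pos.2 hi⟩
  have hb' : b = 1 - a := by linarith
  subst hb'
  simp only [heatedObj, smul_eq_mul, dotProduct_add, add_dotProduct, dotProduct_smul,
    smul_dotProduct, dotProduct_sub, sub_dotProduct] at hpos ⊢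
  have := mul_pos (mul_pos hδ (mul_pos ha hb)) hpos
  rw [dotProduct_comm y x] at *
  nlinarith

lemma continuous_heated {f : (Fin n → ℝ) → Q → ℝ} (hfc : ∀ q, Continuous fun θ => f θ q) (δ : ℝ)
    (a : Q × ℝ) : Continuous fun θ => heated f δ θ a :=
  (hfc a.1).sub continuous_const

lemma convexOn_heated {f : (Fin n → ℝ) → Q → ℝ} (hf : ∀ q, ConvexOn ℝ univ fun θ => f θ q) (δ : ℝ)
    (a : Q × ℝ) : ConvexOn ℝ univ fun θ => heated f δ θ a := by
  simp only [heated, sub_eq_add_neg]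
  exact (hf a.1).add_const (-(δ * a.2))

lemma feasibleSet_subset_heated (Θ : Set (Fin n → ℝ)) (f : (Fin n → ℝ) → Q → ℝ) {δ : ℝ} (hδ : 0 ≤ δ)
    {m : ℕ} {x : Fin m → Q × ℝ} (hx : ∀ i, (x i).2 ∈ Icc (0 : ℝ) 1) :
    feasibleSet Θ f (fun i => (x i).1) univ ⊆ feasibleSet Θ (heated f δ) x univ := by
  refine fun θ h => ⟨h.1, fun i hi => ?_⟩
  have := h.2 i hi
  have := mul_nonneg hδ (hx i).1
  simp only [heated]; linarith

variable [MeasurableSpace Q]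

/-- The law of a scenario with an independent uniform label. -/
noncomputable def labelled (P : Measure Q) : Measure (Q × ℝ) := P.prod (volume.restrict (Icc 0 1))

instance : IsProbabilityMeasure (volume.restrict (Icc (0 : ℝ) 1)) := ⟨by simp⟩

instance (P : Measure Q) [IsProbabilityMeasure P] : IsProbabilityMeasure (labelled P) := by
  unfold labelled; infer_instance

lemma measurable_heated {f : (Fin n → ℝ) → Q → ℝ}
    (hfc : ∀ q, Continuous fun θ => f θ q) (hfm : ∀ θ, Measurable (f θ)) (δ : ℝ) :
    Measurable fun p : (Fin n → ℝ) × (Q × ℝ) => heated f δ p.1 p.2 := by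
  have := measurable_uncurry_of_continuous_of_measurable (u := f) hfc hfm
  have h2 : Measurable fun p : (Fin n → ℝ) × (Q × ℝ) => f p.1 p.2.1 :=
    this.comp (measurable_fst.prodMk (measurable_fst.comp measurable_snd))
  unfold heated
  fun_prop

/-- For each `q` a single label solves the equation, and the uniform law has no atoms. Hence a fresh
scenario is almost never active at a given point. -/
lemma labelled_ae_ne (P : Measure Q) [IsProbabilityMeasure P] {r : Q → ℝ} (hr : Measurable r) {δ : ℝ}
    (hδ : δ ≠ 0) : labelled P {a | r a.1 - δ * a.2 ≠ 0} = 1 := by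
  have hm : MeasurableSet {a : Q × ℝ | r a.1 - δ * a.2 = 0} :=
    measurableSet_eq_fun (by fun_prop) measurable_const
  have : labelled P {a | r a.1 - δ * a.2 = 0} = 0 := by
    rw [labelled, Measure.measure_prod_null hm]
    refine Eventually.of_forall fun q => ?_
    refine measure_mono_null (t := {r q / δ}) (fun z hz => ?_) (by simp)
    have hz : r q - δ * z = 0 := hz
    rw [mem_singleton_iff]; field_simp; linarith
  have h2 := prob_compl_eq_one_sub (μ := labelled P) hm
  rw [this, tsub_zero] at h2
  exact h2

lemma ae_subsample (μ : Measure Q) [IsProbabilityMeasure μ] {k m : ℕ}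
    {R : (Fin k → Q) → Q → Prop} (hR : MeasurableSet {p : (Fin k → Q) × Q | R p.1 p.2})
    (h1 : ∀ y, μ {a | R y a} = 1) (I : Finset (Fin m)) (hI : I.card = k) :
    ∀ᵐ x ∂(Measure.pi fun _ => μ), ∀ j ∉ I, R (subsample I hI x) (x j) := by
  have := measure_subsample_event μ hR I hI MeasurableSet.univ
  simp only [h1, one_pow, Measure.restrict_univ, lintegral_const, measure_univ, mul_one,
    mem_univ, and_true] at this
  have hms : MeasurableSet {x : Fin m → Q | ∀ j ∉ I, R (subsample I hI x) (x j)} := by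
    have : {x : Fin m → Q | ∀ j ∉ I, R (subsample I hI x) (x j)} =
        ⋂ j, ⋂ (_ : j ∉ I), (fun x => (subsample I hI x, x j)) ⁻¹' {p | R p.1 p.2} := by
      ext x; simp
    rw [this]
    exact MeasurableSet.iInter fun j => MeasurableSet.iInter fun _ =>
      ((measurable_subsample I hI).prodMk (measurable_pi_apply j)) hR
  exact (prob_compl_eq_zero_iff hms).2 this

lemma ae_pi_of_ae (μ : Measure Q) [IsProbabilityMeasure μ] {p : Q → Prop} (h : ∀ᵐ a ∂μ, p a)
    (m : ℕ) : ∀ᵐ x ∂(Measure.pi fun _ : Fin m => μ), ∀ i, p (x i) :=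
  ae_all_iff.2 fun i => (measurePreserving_eval (fun _ : Fin m => μ) i).quasiMeasurePreserving.ae h

lemma measurePreserving_unlabel (P : Measure Q) [IsProbabilityMeasure P] (m : ℕ) :
    MeasurePreserving (fun (x : Fin m → Q × ℝ) i => (x i).1) (Measure.pi fun _ => labelled P)
      (Measure.pi fun _ => P) :=
  measurePreserving_pi _ _ fun _ => measurePreserving_fst

lemma ae_label_mem (P : Measure Q) [IsProbabilityMeasure P] (m : ℕ) :
    ∀ᵐ x ∂(Measure.pi fun _ : Fin m => labelled P), ∀ i, (x i).2 ∈ Icc (0 : ℝ) 1 :=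
  ae_pi_of_ae _ ((measurePreserving_snd (μ := P)).quasiMeasurePreserving.ae
    (ae_restrict_mem measurableSet_Icc)) m

/-- Tail bound for the violation probability of the heated scenario problem. -/
lemma heated_tail (hn : 1 ≤ n) (P : Measure Q) [IsProbabilityMeasure P]
    (c : Fin n → ℝ) {Θ : Set (Fin n → ℝ)} (hΘ : Convex ℝ Θ) (hΘc : IsCompact Θ)
    {f : (Fin n → ℝ) → Q → ℝ} (hf : ∀ q, ConvexOn ℝ univ fun θ => f θ q)
    (hfc : ∀ q, Continuous fun θ => f θ q)
    (hfm : ∀ θ, Measurable (f θ)) {N : ℕ} (hN : n ≤ N)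
    (hsolv : ∀ m, N ≤ m → UniquelySolvable P c Θ f m) {δ : ℝ} (hδ : 0 < δ) (t : ℝ) :
    ∃ A : Set (Fin N → Q × ℝ), Measure.pi (fun _ => labelled P) A ≤
        betaMeasure ((N : ℝ) + 1 - n) n (Iio (1 - t)) ∧
      ∀ᵐ x ∂(Measure.pi fun _ => labelled P), ∀ θ ∈ feasibleSet Θ (heated f δ) x univ,
        IsMinOn (heatedObj c δ) (feasibleSet Θ (heated f δ) x univ) θ →
        t < (labelled P).real {a | 0 < heated f δ θ a} → x ∈ A := by
  classical
  set g := heated f δ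
  set h := heatedObj c δ
  have hg := convexOn_heated hf δ
  have hgc := continuous_heated hfc δ
  have hgm := measurable_heated hfc hfm δ
  have hh := strictConvexOn_heatedObj c hδ
  have hhc : Continuous h := continuous_heatedObj c δ
  have hexmin : ∀ {m : ℕ} (y : Fin m → Q × ℝ), (feasibleSet Θ g y univ).Nonempty →
      ∃ θ, θ ∈ feasibleSet Θ g y univ ∧ IsMinOn h (feasibleSet Θ g y univ) θ := fun y hy =>
    (isCompact_feasibleSet hΘc hgc y univ).exists_isMinOn hy hhc.continuousOn
  set F : Set (Fin n → Q × ℝ) := {y | (feasibleSet Θ g y univ).Nonempty} with hF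
  set sol : (Fin n → Q × ℝ) → Fin n → ℝ := fun y =>
    if hy : (feasibleSet Θ g y univ).Nonempty then (hexmin y hy).choose else 0 with hsoldef
  have hsol : ∀ y, (feasibleSet Θ g y univ).Nonempty →
      sol y ∈ feasibleSet Θ g y univ ∧ IsMinOn h (feasibleSet Θ g y univ) (sol y) := by
    intro y hy
    simp only [hsoldef, hy, dif_pos]
    exact (hexmin y hy).choose_spec
  have hgmi : ∀ (i : Fin n) (θ : Fin n → ℝ), Measurable fun y : Fin n → Q × ℝ => g θ (y i) :=
    fun i θ => hgm.comp (measurable_const.prodMk (measurable_pi_apply i))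
  have hFm : MeasurableSet F := by
    have := measurableSet_exists_le hΘc (g := fun i θ (y : Fin n → Q × ℝ) => g θ (y i))
      (fun i y => hgc (y i)) hgmi
    convert! this using 1
    ext y; simp [hF, feasibleSet, Set.Nonempty]
  have hsolm : Measurable sol := by
    refine measurable_argmin hΘc hhc (g := fun i θ (y : Fin n → Q × ℝ) => g θ (y i))
      (fun i y => hgc (y i)) hgmi hFm 0 (fun y hy => ?_) fun y hy => ?_
    · obtain ⟨h1, h2⟩ := hsol y hy
      refine ⟨⟨h1.1, fun i => h1.2 i (mem_univ _)⟩, fun θ hθ hθg => ?_⟩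
      have hθ' : θ ∈ feasibleSet Θ g y univ := ⟨hθ, fun i _ => hθg i⟩
      refine ⟨h2 hθ', fun hle => ?_⟩
      refine (hh.subset (subset_univ _) (convex_feasibleSet hΘ hg y univ)).eq_of_isMinOn
        (fun p hp => hle.trans (h2 hp)) h2 hθ' h1
    · exact dif_neg hy
  -- The same label relaxes the constraint and ranks the padding.
  set R := Keeps g Prod.snd sol
  have hRm : MeasurableSet {p : (Fin n → Q × ℝ) × (Q × ℝ) | R p.1 p.2} := by
    have e : {p : (Fin n → Q × ℝ) × (Q × ℝ) | R p.1 p.2} = {p | g (sol p.1) p.2 ≤ 0} ∩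
        ⋂ i, ({p | g (sol p.1) (p.1 i) = 0} ∪ {p | p.2.2 < (p.1 i).2}) := by
      ext p
      simp only [R, Keeps, mem_ofPred_eq, mem_inter_iff, mem_iInter, mem_union, ne_eq,
        or_iff_not_imp_left]
    rw [e]
    refine MeasurableSet.inter (measurableSet_le ?_ measurable_const)
      (MeasurableSet.iInter fun i => MeasurableSet.union (measurableSet_eq_fun ?_ measurable_const)
        (measurableSet_lt (by fun_prop) (by fun_prop)))
    · exact hgm.comp ((hsolm.comp measurable_fst).prodMk measurable_snd)
    · exact hgm.comp ((hsolm.comp measurable_fst).prodMk (by fun_prop))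
  have hgen : ∀ m, N ≤ m → ∀ᵐ x ∂(Measure.pi fun _ : Fin m => labelled P),
      (feasibleSet Θ g x univ).Nonempty ∧ (Function.Injective fun i => (x i).2) ∧
      ∀ I : Finset (Fin m), ∀ hI : I.card = n, ∀ j ∉ I, g (sol (subsample I hI x)) (x j) ≠ 0 := by
    intro m hm
    have a1 := (measurePreserving_unlabel P m).quasiMeasurePreserving.ae (hsolv m hm)
    have a2 := ae_label_mem P m
    have a3 : ∀ᵐ x ∂(Measure.pi fun _ : Fin m => labelled P),
        ∀ I : Finset (Fin m), ∀ hI : I.card = n, ∀ j ∉ I, g (sol (subsample I hI x)) (x j) ≠ 0 := by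
      refine ae_all_iff.2 fun I => ?_
      by_cases hI : I.card = n
      · have := ae_subsample (labelled P) (R := fun y a => g (sol y) a ≠ 0) ?_ ?_ I hI
        · filter_upwards [this] with x hx _
          exact hx
        · exact (measurableSet_eq_fun (hgm.comp ((hsolm.comp measurable_fst).prodMk measurable_snd))
            measurable_const).compl
        · exact fun y => labelled_ae_ne P (hfm _) hδ.ne'
      · exact Eventually.of_forall fun x h => absurd h hI
    -- Labels are pairwise distinct: each is compared with a subsample of size 1.
    have a4 : ∀ᵐ x ∂(Measure.pi fun _ : Fin m => labelled P),
        ∀ i j : Fin m, j ≠ i → (x j).2 ≠ (x i).2 := by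
      refine ae_all_iff.2 fun i => ?_
      have := ae_subsample (labelled P) (k := 1) (R := fun y a => a.2 ≠ (y 0).2) ?_ ?_ {i}
        (Finset.card_singleton i)
      · filter_upwards [this] with x hx j hj
        have := hx j (by simpa using hj)
        simpa [subsample] using this
      · exact (measurableSet_eq_fun (by fun_prop) (by fun_prop)).compl
      · intro y
        have := labelled_ae_ne P (r := fun _ => (y 0).2) measurable_const one_ne_zero
        convert! this using 2
        ext a
        simp only [mem_ofPred_eq, one_mul]
        rw [sub_ne_zero, ne_comm]
    filter_upwards [a1, a2, a3, a4] with x h1 h2 h3 h4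
    obtain ⟨θ, hθ, _⟩ := h1
    exact ⟨⟨θ, feasibleSet_subset_heated Θ f hδ.le h2 hθ.1⟩,
      fun i j hij => by by_contra hne; exact h4 j i hne hij, h3⟩
  have hex : ∀ m, N ≤ m → ∀ᵐ x ∂(Measure.pi fun _ : Fin m => labelled P),
      ∃! I, Compatible R x I := by
    intro m hm
    filter_upwards [hgen m hm] with x ⟨h1, h2, h3⟩
    obtain ⟨θ, hθ, hmin⟩ := hexmin x h1
    exact (existsUnique_compatible hΘ hg hgc hh (hN.trans hm) Prod.snd hsol x h2 h3 hθ hmin).1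
  refine ⟨_, compression_tail_le (labelled P) hn hN hRm hex (1 - t), ?_⟩
  filter_upwards [hgen N le_rfl] with x ⟨h1, h2, h3⟩ θ hθ hmin ht
  obtain ⟨⟨I, ⟨hI, hIc⟩, _⟩, heq⟩ :=
    existsUnique_compatible hΘ hg hgc hh hN Prod.snd hsol x h2 h3 hθ hmin
  refine ⟨I, hI, hIc, ?_⟩
  have hsolθ := heq I hI ⟨hI, hIc⟩
  have hms : MeasurableSet {a | 0 < g θ a} :=
    measurableSet_lt measurable_const (hgm.comp (measurable_const.prodMk measurable_id))
  -- Compatible scenarios are not violated. The padding condition may exclude more, so this is only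
  -- an inequality.
  have hle : (labelled P).real {z | R (subsample I hI x) z} ≤
      (labelled P).real {a | 0 < g θ a}ᶜ := by
    refine measureReal_mono fun z hz => ?_
    have := hz.1
    rw [hsolθ] at this
    simpa using this
  rw [probReal_compl_eq_one_sub hms] at hle
  linarith

end Heating

/-! ### The limit δ → 0 and the beta bound for the original problem. -/

section Cooling

variable {n : ℕ} {Q : Type*}

lemma scenarioSol_spec {c : Fin n → ℝ} {Θ : Set (Fin n → ℝ)} {f : (Fin n → ℝ) → Q → ℝ} {m : ℕ}
    {ω : Fin m → Q} (h : ∃! θ, IsOptimal c Θ f ω θ) :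
    IsOptimal c Θ f ω (scenarioSol c Θ f ω) ∧
      ∀ θ, IsOptimal c Θ f ω θ → θ = scenarioSol c Θ f ω := by
  have hs : IsOptimal c Θ f ω (scenarioSol c Θ f ω) := by
    rw [scenarioSol, dif_pos h.exists]
    exact h.exists.choose_spec
  exact ⟨hs, fun θ hθ => h.unique hθ hs⟩

/-- Solutions of the heated problems converge to the unique solution of the scenario problem. -/
lemma tendsto_heated {c : Fin n → ℝ} {Θ : Set (Fin n → ℝ)} (hΘc : IsCompact Θ)
    {f : (Fin n → ℝ) → Q → ℝ} (hfc : ∀ q, Continuous fun θ => f θ q) {m : ℕ} {x : Fin m → Q × ℝ}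
    (hx : ∀ i, (x i).2 ∈ Icc (0 : ℝ) 1) (huniq : ∃! θ, IsOptimal c Θ f (fun i => (x i).1) θ)
    {δ : ℕ → ℝ} (hδ0 : ∀ k, 0 < δ k) (hδ : Tendsto δ atTop (𝓝 0)) {θ : ℕ → Fin n → ℝ}
    (hθ : ∀ k, θ k ∈ feasibleSet Θ (heated f (δ k)) x univ)
    (hmin : ∀ k, IsMinOn (heatedObj c (δ k)) (feasibleSet Θ (heated f (δ k)) x univ) (θ k)) :
    Tendsto θ atTop (𝓝 (scenarioSol c Θ f fun i => (x i).1)) := by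
  obtain ⟨hs, hs'⟩ := scenarioSol_spec huniq
  set p := scenarioSol c Θ f fun i => (x i).1
  refine hΘc.tendsto_nhds_of_unique_mapClusterPt (Eventually.of_forall fun k => (hθ k).1)
    fun r hr hcl => hs' r ?_
  obtain ⟨φ, hφ, hlim⟩ := hcl.tendsto_subseq
  have hδφ := hδ.comp hφ.tendsto_atTop
  -- `p` is feasible for every heated problem, and the quadratic term at `θ k` is nonnegative and
  -- can be dropped.
  have hcp : c ⬝ᵥ r ≤ c ⬝ᵥ p := by
    have h1 : Tendsto (fun k => c ⬝ᵥ θ (φ k)) atTop (𝓝 (c ⬝ᵥ r)) :=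
      ((continuous_dotProduct_const c).tendsto r).comp hlim
    have h2 : Tendsto (fun k => c ⬝ᵥ p + δ (φ k) * (p ⬝ᵥ p)) atTop (𝓝 (c ⬝ᵥ p + 0 * (p ⬝ᵥ p))) :=
      (hδφ.mul_const _).const_add _
    rw [zero_mul, add_zero] at h2
    refine le_of_tendsto_of_tendsto h1 h2 (Eventually.of_forall fun k => ?_)
    have h3 := isMinOn_iff.1 (hmin (φ k)) p
      (feasibleSet_subset_heated Θ f (hδ0 _).le hx hs.1)
    have h4 : 0 ≤ δ (φ k) * (θ (φ k) ⬝ᵥ θ (φ k)) :=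
      mul_nonneg (hδ0 _).le (Finset.sum_nonneg fun i _ => mul_self_nonneg _)
    simp only [heatedObj] at h3
    linarith
  refine ⟨⟨hr, fun i _ => ?_⟩, fun θ' hθ' => hcp.trans (hs.2 θ' hθ')⟩
  have h1 : Tendsto (fun k => f (θ (φ k)) (x i).1) atTop (𝓝 (f r (x i).1)) :=
    ((hfc _).tendsto r).comp hlim
  have h2 : Tendsto (fun k => δ (φ k) * (x i).2) atTop (𝓝 (0 * (x i).2)) := hδφ.mul_const _
  rw [zero_mul] at h2
  refine le_of_tendsto_of_tendsto h1 h2 (Eventually.of_forall fun k => ?_)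
  have := (hθ (φ k)).2 i (mem_univ _)
  simp only [heated] at this
  linarith

lemma measure_eventually_le {α : Type*} [MeasurableSpace α] (μ : Measure α) {A : ℕ → Set α}
    {b : ENNReal} (hA : ∀ k, μ (A k) ≤ b) : μ {x | ∀ᶠ k in atTop, x ∈ A k} ≤ b := by
  have : {x | ∀ᶠ k in atTop, x ∈ A k} = ⋃ K, {x | ∀ k, K ≤ k → x ∈ A k} := by
    ext x; simp [eventually_atTop]
  have hmono : Monotone fun K : ℕ => {x | ∀ k, K ≤ k → x ∈ A k} :=
    fun K L hKL x hx k hk => hx k (hKL.trans hk)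
  rw [this, hmono.measure_iUnion]
  exact iSup_le fun K => (measure_mono fun x (hx : ∀ k, K ≤ k → x ∈ A k) => hx K le_rfl).trans (hA K)

/-- Fatou for sets: `E` lies in the limit inferior of the `A k`. -/
lemma eventually_lt_measureReal {α : Type*} [MeasurableSpace α] (μ : Measure α)
    [IsProbabilityMeasure μ] {A : ℕ → Set α} {E : Set α} (hE : ∀ x ∈ E, ∀ᶠ k in atTop, x ∈ A k)
    {t : ℝ} (ht : t < μ.real E) : ∀ᶠ k in atTop, t < μ.real (A k) := by
  have hmono : Monotone fun K : ℕ => {x | ∀ k, K ≤ k → x ∈ A k} :=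
    fun K L hKL x hx k hk => hx k (hKL.trans hk)
  have hlim := tendsto_measure_iUnion_atTop (μ := μ) hmono
  have hlim' := (ENNReal.tendsto_toReal (measure_ne_top μ _)).comp hlim
  have hsub : E ⊆ ⋃ K, {x | ∀ k, K ≤ k → x ∈ A k} := fun x hx => by
    obtain ⟨K, hK⟩ := eventually_atTop.1 (hE x hx)
    exact mem_iUnion.2 ⟨K, hK⟩
  filter_upwards [hlim'.eventually_const_lt (ht.trans_le (measureReal_mono hsub))] with K hK
  exact lt_of_lt_of_le hK (measureReal_mono fun x (hx : ∀ k, K ≤ k → x ∈ A k) => hx K le_rfl)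

variable [MeasurableSpace Q]

/-- Off a measurable null set containing all failures of unique solvability, `measurable_argmin`
applies. -/
lemma aemeasurable_scenarioSol {P : Measure Q} {c : Fin n → ℝ} {Θ : Set (Fin n → ℝ)}
    (hΘc : IsCompact Θ) {f : (Fin n → ℝ) → Q → ℝ} (hfc : ∀ q, Continuous fun θ => f θ q)
    (hfm : ∀ θ, Measurable (f θ)) {N : ℕ} (hsolv : UniquelySolvable P c Θ f N) :
    AEMeasurable (scenarioSol c Θ f) (Measure.pi fun _ : Fin N => P) := by
  classical
  obtain ⟨T, hT, hTm, hT0⟩ := exists_measurable_superset_of_null (ae_iff.1 hsolv)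
  have hTS : ∀ y ∈ Tᶜ, ∃! θ, IsOptimal c Θ f y θ := fun y hy => by
    by_contra hcon; exact hy (hT hcon)
  refine ⟨fun y => if y ∈ Tᶜ then scenarioSol c Θ f y else 0, ?_, ?_⟩
  · refine measurable_argmin hΘc (continuous_dotProduct_const c)
      (g := fun i θ (y : Fin N → Q) => f θ (y i)) (fun i y => hfc _)
      (fun i θ => (hfm θ).comp (measurable_pi_apply i)) hTm.compl 0 (fun y hy => ?_)
      fun y hy => if_neg hy
    simp only [if_pos hy]
    obtain ⟨h1, h2⟩ := scenarioSol_spec (hTS y hy)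
    refine ⟨⟨h1.1.1, fun i => h1.1.2 i (mem_univ _)⟩, fun θ hθ hθg => ?_⟩
    refine ⟨h1.2 θ ⟨hθ, fun i _ => hθg i⟩, fun hle => h2 θ ?_⟩
    exact ⟨⟨hθ, fun i _ => hθg i⟩, fun θ' hθ' => hle.trans (h1.2 θ' hθ')⟩
  · have : ∀ᵐ y ∂(Measure.pi fun _ : Fin N => P), y ∉ T := measure_eq_zero_iff_ae_notMem.1 hT0
    filter_upwards [this] with y hy
    exact (if_pos hy).symm

lemma measurableSet_violated {f : (Fin n → ℝ) → Q → ℝ} (hfc : ∀ q, Continuous fun θ => f θ q)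
    (hfm : ∀ θ, Measurable (f θ)) : MeasurableSet {p : (Fin n → ℝ) × Q | 0 < f p.1 p.2} :=
  measurableSet_lt measurable_const (measurable_uncurry_of_continuous_of_measurable hfc hfm)

lemma measurable_violation (P : Measure Q) [IsProbabilityMeasure P] {f : (Fin n → ℝ) → Q → ℝ}
    (hfc : ∀ q, Continuous fun θ => f θ q) (hfm : ∀ θ, Measurable (f θ)) :
    Measurable (violation P f) :=
  (measurable_measure_prodMk_left (measurableSet_violated hfc hfm)).ennreal_toReal

/-- The violation probability of the scenario solution is stochastically dominated by a beta
distribution. -/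
lemma violation_tail_le (hn : 1 ≤ n) (P : Measure Q) [IsProbabilityMeasure P]
    {c : Fin n → ℝ} {Θ : Set (Fin n → ℝ)} (hΘ : Convex ℝ Θ) (hΘc : IsCompact Θ)
    {f : (Fin n → ℝ) → Q → ℝ} (hf : ∀ q, ConvexOn ℝ univ fun θ => f θ q)
    (hfc : ∀ q, Continuous fun θ => f θ q)
    (hfm : ∀ θ, Measurable (f θ)) {N : ℕ} (hN : n ≤ N)
    (hsolv : ∀ m, N ≤ m → UniquelySolvable P c Θ f m) (t : ℝ) :
    Measure.pi (fun _ : Fin N => P) {ω | t < violation P f (scenarioSol c Θ f ω)} ≤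
      betaMeasure ((N : ℝ) + 1 - n) n (Iio (1 - t)) := by
  have hV : NullMeasurableSet {ω | t < violation P f (scenarioSol c Θ f ω)}
      (Measure.pi fun _ : Fin N => P) :=
    nullMeasurableSet_lt aemeasurable_const ((measurable_violation P hfc hfm).comp_aemeasurable
      (aemeasurable_scenarioSol hΘc hfc hfm (hsolv N le_rfl)))
  rw [← (measurePreserving_unlabel P N).measure_preimage hV]
  set δ : ℕ → ℝ := fun k => 1 / ((k : ℝ) + 1)
  have hδ0 : ∀ k, 0 < δ k := fun k => by positivity
  have hδ : Tendsto δ atTop (𝓝 0) := tendsto_one_div_add_atTop_nhds_zero_nat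
  choose A hA hAx using fun k => heated_tail hn P c hΘ hΘc hf hfc hfm hN hsolv (hδ0 k) t
  -- If the limit solution has violation above `t`, so do the heated ones for large `k`, and `x` is
  -- eventually in `A k`.
  refine (measure_mono_ae ?_).trans (measure_eventually_le _ hA)
  have a1 := (measurePreserving_unlabel P N).quasiMeasurePreserving.ae (hsolv N le_rfl)
  filter_upwards [a1, ae_label_mem P N, ae_all_iff.2 hAx] with x h1 h2 h3 ht
  change t < violation P f (scenarioSol c Θ f fun i => (x i).1) at ht
  change ∀ᶠ k in atTop, x ∈ A k
  have hne : ∀ k, (feasibleSet Θ (heated f (δ k)) x univ).Nonempty := fun k =>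
    ⟨_, feasibleSet_subset_heated Θ f (hδ0 k).le h2 (scenarioSol_spec h1).1.1⟩
  choose θ hθ hmin using fun k => (isCompact_feasibleSet hΘc (continuous_heated hfc (δ k)) x
    univ).exists_isMinOn (hne k) (continuous_heatedObj c (δ k)).continuousOn
  have hlim := tendsto_heated hΘc hfc h2 h1 hδ0 hδ hθ hmin
  have hvio : t < (labelled P).real {a | 0 < f (scenarioSol c Θ f fun i => (x i).1) a.1} := by
    have hm : MeasurableSet {q | 0 < f (scenarioSol c Θ f fun i => (x i).1) q} :=
      measurableSet_lt measurable_const (hfm _)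
    have := (measurePreserving_fst (μ := P) (ν := volume.restrict (Icc (0 : ℝ) 1))).measure_preimage
      hm.nullMeasurableSet
    rw [violation, Measure.real, ← this] at ht
    exact ht
  have hev := eventually_lt_measureReal (labelled P) (A := fun k => {a | 0 < heated f (δ k) (θ k) a})
    (fun a (ha : 0 < f _ a.1) => ?_) hvio
  · exact hev.mono fun k hk => h3 k (θ k) (hθ k) (hmin k) hk
  -- Strict violation is an open condition, so it persists for the heated constraint near the limit.
  · have h4 : Tendsto (fun k => heated f (δ k) (θ k) a) atTop
        (𝓝 (f (scenarioSol c Θ f fun i => (x i).1) a.1 - 0 * a.2)) :=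
      (((hfc a.1).tendsto _).comp hlim).sub (hδ.mul_const _)
    rw [zero_mul, sub_zero] at h4
    exact h4.eventually_const_lt ha

end Cooling

/-! ### Binomial distribution functions and their beta mixtures. -/

section Binomial

/-- Probability that a binomial variable with parameters `M` and `v` is at most `k`. -/
def binomCDF (k M : ℕ) (v : ℝ) : ℝ :=
  ∑ i ∈ Finset.range (k + 1), (M.choose i : ℝ) * (v ^ i * (1 - v) ^ (M - i))

lemma measurable_binomCDF (k M : ℕ) : Measurable (binomCDF k M) := by
  unfold binomCDF; fun_prop

/-- At most `k` successes means at least `M - k` failures. The beta form makes monotonicity in `v`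
visible. -/
lemma binomCDF_eq_Fbeta {k M : ℕ} (hk : k < M) {v : ℝ} (h0 : 0 ≤ v) (h1 : v ≤ 1) :
    binomCDF k M v = Fbeta ((M : ℝ) - k) ((k : ℝ) + 1) (1 - v) := by
  have := sum_binomial_Icc (a := M - k) (M := M) (by omega) (by omega) (t := 1 - v) (by linarith)
    (by linarith)
  rw [Nat.cast_sub hk.le, show (M : ℝ) + 1 - (M - k) = k + 1 by ring, sub_sub_cancel] at this
  rw [← this, binomCDF]
  refine Finset.sum_nbij' (fun i => M - i) (fun i => M - i) ?_ ?_ ?_ ?_ ?_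
  · intro i hi; rw [Finset.mem_range] at hi; rw [Finset.mem_Icc]; omega
  · intro i hi; rw [Finset.mem_Icc] at hi; rw [Finset.mem_range]; omega
  · intro i hi; rw [Finset.mem_range] at hi; omega
  · intro i hi; rw [Finset.mem_Icc] at hi; omega
  · intro i hi
    rw [Finset.mem_range] at hi
    rw [Nat.choose_symm (by omega), show M - (M - i) = i by omega]
    ring

lemma binomCDF_of_le {k M : ℕ} (hk : M ≤ k) (v : ℝ) : binomCDF k M v = 1 := by
  rw [binomCDF, ← Finset.sum_subset (Finset.range_subset_range.2 (Nat.succ_le_succ hk))]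
  · have := add_pow v (1 - v) M
    rw [add_sub_cancel, one_pow] at this
    exact (Finset.sum_congr rfl fun i _ => by ring).trans this.symm
  · intro i _ hi
    rw [Finset.mem_range] at hi
    rw [Nat.choose_eq_zero_of_lt (by omega)]; simp

lemma binomCDF_antitoneOn (k M : ℕ) : AntitoneOn (binomCDF k M) (Icc 0 1) := by
  rcases lt_or_ge k M with hk | hk
  · intro u hu v hv huv
    rw [binomCDF_eq_Fbeta hk hu.1 hu.2, binomCDF_eq_Fbeta hk hv.1 hv.2]
    have : (k : ℝ) < M := by exact_mod_cast hk
    exact Fbeta_mono (by linarith) (by positivity) (by linarith [hv.2]) (by linarith)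
  · intro u _ v _ _
    rw [binomCDF_of_le hk, binomCDF_of_le hk]

lemma binomCDF_nonneg (k M : ℕ) {v : ℝ} (hv : v ∈ Icc (0 : ℝ) 1) : 0 ≤ binomCDF k M v :=
  Finset.sum_nonneg fun i _ => mul_nonneg (by positivity)
    (mul_nonneg (pow_nonneg hv.1 _) (pow_nonneg (by linarith [hv.2]) _))

lemma binomCDF_le_one (k M : ℕ) {v : ℝ} (hv : v ∈ Icc (0 : ℝ) 1) : binomCDF k M v ≤ 1 := by
  have h := binomCDF_antitoneOn k M (left_mem_Icc.2 zero_le_one) hv hv.1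
  have : binomCDF k M 0 = 1 := by
    rw [binomCDF, Finset.sum_range_succ']
    simp
  linarith

/-- The number of i.i.d. samples that fall into a set is binomially distributed. -/
lemma measureReal_card_le {Q : Type*} [MeasurableSpace Q] (P : Measure Q) [IsProbabilityMeasure P]
    {A : Set Q} [DecidablePred (· ∈ A)] (hA : MeasurableSet A) (M k : ℕ) :
    (Measure.pi fun _ : Fin M => P).real
      {ω | (Finset.univ.filter fun i => ω i ∈ A).card ≤ k} = binomCDF k M (P.real A) := by
  classical
  have hbox : ∀ S : Finset (Fin M), {ω : Fin M → Q | (Finset.univ.filter fun i => ω i ∈ A) = S} =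
      Set.pi univ fun i => if i ∈ S then A else Aᶜ := by
    intro S
    ext ω
    simp only [mem_ofPred_eq, Finset.ext_iff, Finset.mem_filter, Finset.mem_univ, true_and,
      mem_univ_pi]
    refine forall_congr' fun i => ?_
    by_cases hi : i ∈ S <;> simp [hi]
  have hmeas : ∀ S : Finset (Fin M),
      MeasurableSet {ω : Fin M → Q | (Finset.univ.filter fun i => ω i ∈ A) = S} := by
    intro S
    rw [hbox]
    refine MeasurableSet.univ_pi fun i => ?_
    split_ifs
    exacts [hA, hA.compl]
  have hval : ∀ S : Finset (Fin M), (Measure.pi fun _ : Fin M => P).real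
      {ω : Fin M → Q | (Finset.univ.filter fun i => ω i ∈ A) = S} =
      P.real A ^ S.card * (1 - P.real A) ^ (M - S.card) := by
    intro S
    rw [hbox, Measure.real, Measure.pi_pi, ENNReal.toReal_prod]
    have : ∀ i, (P (if i ∈ S then A else Aᶜ)).toReal =
        if i ∈ S then P.real A else 1 - P.real A := by
      intro i
      split_ifs
      · rfl
      · exact probReal_compl_eq_one_sub hA
    simp_rw [this]
    rw [Finset.prod_ite, Finset.prod_const, Finset.prod_const, Finset.filter_mem_eq_inter,
      Finset.univ_inter, Finset.filter_not, Finset.filter_mem_eq_inter, Finset.univ_inter,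
      Finset.card_univ_sdiff, Fintype.card_fin]
  have hunion : {ω : Fin M → Q | (Finset.univ.filter fun i => ω i ∈ A).card ≤ k} =
      ⋃ S ∈ (Finset.univ : Finset (Fin M)).powerset.filter (fun S => S.card ≤ k),
        {ω : Fin M → Q | (Finset.univ.filter fun i => ω i ∈ A) = S} := by
    ext ω; simp
  rw [hunion, measureReal_biUnion_finset ?_ fun S _ => hmeas S, Finset.sum_congr rfl fun S _ => hval S,
    Finset.sum_filter,
    Finset.sum_powerset_apply_card
      (fun i => if i ≤ k then P.real A ^ i * (1 - P.real A) ^ (M - i) else 0),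
    Finset.card_univ, Fintype.card_fin, binomCDF]
  · simp only [nsmul_eq_mul, mul_ite, mul_zero]
    rw [← Finset.sum_filter]
    refine Finset.sum_subset (fun i hi => ?_) fun i hi hi' => ?_
    · rw [Finset.mem_filter] at hi
      rw [Finset.mem_range]; omega
    · rw [Finset.mem_range] at hi
      rw [Finset.mem_filter, Finset.mem_range, not_and_or] at hi'
      rw [Nat.choose_eq_zero_of_lt (by omega)]; simp
  · intro S _ T _ hST
    refine Set.disjoint_left.2 fun ω hS hT => hST ?_
    exact (show _ = S from hS).symm.trans hT

/-- By conjugacy each binomial term times the beta density is a beta-binomial weight times a beta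
density with updated parameters. -/
lemma integral_binomCDF_betaMeasure {n N : ℕ} (hn : 1 ≤ n) (hN : n ≤ N) {k M : ℕ} (hk : k ≤ M)
    {ε : ℝ} (hε : 0 ≤ ε) :
    ∫ v, (Iic ε).indicator (binomCDF k M) v ∂(betaMeasure n ((N : ℝ) + 1 - n)) =
      ∑ i ∈ Finset.range (k + 1), fbb M n ((N : ℝ) + 1 - n) i *
        Fbeta ((n : ℝ) + i) ((N : ℝ) + M - n - i + 1) ε := by
  have ha : (0 : ℝ) < n := by exact_mod_cast hn
  have hb : (0 : ℝ) < (N : ℝ) + 1 - n := by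
    have : (n : ℝ) ≤ N := by exact_mod_cast hN
    linarith
  rw [integral_betaMeasure ha hb]
  have hpt : ∀ v, betaPDFReal n ((N : ℝ) + 1 - n) v * (Iic ε).indicator (binomCDF k M) v =
      ∑ i ∈ Finset.range (k + 1), fbb M n ((N : ℝ) + 1 - n) i *
        (Iic ε).indicator (betaPDFReal ((n : ℝ) + i) ((N : ℝ) + M - n - i + 1)) v := by
    intro v
    by_cases hv : v ∈ Iic ε
    · simp only [indicator_of_mem hv, binomCDF, Finset.mul_sum]
      refine Finset.sum_congr rfl fun i hi => ?_
      have hi : i ≤ M := by rw [Finset.mem_range] at hi; omega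
      have := pow_mul_betaPDFReal ha hb i (M - i) v
      rw [Nat.cast_sub hi, show (N : ℝ) + 1 - n + (M - i) = N + M - n - i + 1 by ring] at this
      rw [fbb, show (M : ℝ) - i + (N + 1 - n) = N + M - n - i + 1 by ring, add_comm (i : ℝ),
        mul_assoc, ← this]
      ring
    · simp [indicator_of_notMem hv]
  simp_rw [hpt]
  have hpos : ∀ i ∈ Finset.range (k + 1), (0 : ℝ) < (N : ℝ) + M - n - i + 1 := by
    intro i hi
    have : (i : ℝ) ≤ M := by
      rw [Finset.mem_range] at hi
      exact_mod_cast (show i ≤ M by omega)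
    linarith
  rw [integral_finsetSum _ fun i hi =>
    ((integrable_betaPDFReal (by positivity) (hpos i hi)).indicator measurableSet_Iic).const_mul _]
  refine Finset.sum_congr rfl fun i hi => ?_
  have hai : (0 : ℝ) < (n : ℝ) + i := by positivity
  rw [integral_const_mul, ← betaMeasure_Iic hai (hpos i hi) hε,
    ← integral_indicator_one measurableSet_Iic, integral_betaMeasure hai (hpos i hi)]
  congr 2; ext v
  by_cases hv : v ∈ Iic ε <;> simp [hv]

lemma one_sub_H_eq {n N : ℕ} (hn : 1 ≤ n) (hN : n ≤ N) (No : ℕ) {ε ε' : ℝ} (hε : 0 ≤ ε)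
    (hε' : ε' ∈ Icc (0 : ℝ) 1) :
    1 - H n N No ε ε' =
      ∫ v, (Iic ε).indicator (binomCDF ⌊ε' * No⌋₊ No) v ∂(betaMeasure n ((N : ℝ) + 1 - n)) := by
  rw [integral_binomCDF_betaMeasure hn hN _ hε, H, sub_sub_cancel]
  refine Nat.floor_le_of_le ?_
  exact mul_le_of_le_one_left (by positivity) hε'.2

lemma H_one {n N : ℕ} (hn : 1 ≤ n) (hN : n ≤ N) (No : ℕ) {ε' : ℝ} (hε' : ε' ∈ Icc (0 : ℝ) 1) :
    H n N No 1 ε' = H1 n N No ε' := by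
  rw [H, H1]
  congr 1
  refine Finset.sum_congr rfl fun i hi => ?_
  have hnN : (n : ℝ) ≤ N := by exact_mod_cast hN
  have hn0 : (1 : ℝ) ≤ n := by exact_mod_cast hn
  have hi1 : (i : ℝ) ≤ ε' * No :=
    (Nat.le_floor_iff (mul_nonneg hε'.1 (by positivity))).1 (Nat.lt_succ_iff.1 (Finset.mem_range.1 hi))
  have hi2 : ε' * No ≤ No := mul_le_of_le_one_left (by positivity) hε'.2
  rw [Fbeta_one (by positivity) (by linarith), mul_one]

/-- Termwise: `i ≤ ε' No`, so replacing `i` by `ε' No` in the beta parameters lowers the value, and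
reflection turns that value into `1 - betaBar`. -/
lemma one_sub_betaBar_mul_le {n N : ℕ} (hn : 1 ≤ n) (hN : n ≤ N) (No : ℕ) {ε ε' : ℝ}
    (hε : ε ∈ Icc (0 : ℝ) 1) (hε' : ε' ∈ Icc (0 : ℝ) 1) :
    (1 - betaBar n N No ε ε') * (1 - H1 n N No ε') ≤ 1 - H n N No ε ε' := by
  have hnN : (n : ℝ) ≤ N := by exact_mod_cast hN
  have hn0 : (1 : ℝ) ≤ n := by exact_mod_cast hn
  have hNo : (0 : ℝ) ≤ No := by positivity
  have h0 : 0 ≤ ε' * No := mul_nonneg hε'.1 hNo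
  have h1 : ε' * No ≤ No := mul_le_of_le_one_left hNo hε'.2
  rw [betaBar, Fbeta_one_sub (by nlinarith) (by linarith), sub_sub_cancel, H, H1, sub_sub_cancel,
    sub_sub_cancel, Finset.mul_sum]
  refine Finset.sum_le_sum fun i hi => ?_
  have hi1 : (i : ℝ) ≤ ε' * No :=
    (Nat.le_floor_iff h0).1 (Nat.lt_succ_iff.1 (Finset.mem_range.1 hi))
  rw [mul_comm]
  refine mul_le_mul_of_nonneg_left (Fbeta_param_mono (by positivity) (by nlinarith) (by linarith)
    (by nlinarith) hε.1 hε.2) ?_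
  exact mul_nonneg (by positivity) (div_nonneg (beta_pos (by positivity) (by linarith)).le
    (beta_pos (by linarith) (by linarith)).le)

lemma betaTail_eq {n N : ℕ} (hn : 1 ≤ n) (hN : n ≤ N) {ε : ℝ} (hε : ε ∈ Icc (0 : ℝ) 1) :
    betaTail n N ε = 1 - Fbeta n ((N : ℝ) + 1 - n) ε := by
  rw [betaTail, sum_binomial_Icc hn hN hε.1 hε.2]

end Binomial

/-! ### Probabilities of the events of one iteration. -/

section Iteration

variable {n : ℕ} {Q : Type*}

/-- If the solution without `j` satisfies constraint `j`, it is feasible for the full problem and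
the value does not drop. If it violates `j`, equal values would contradict its uniqueness. -/
lemma isSupport_iff {c : Fin n → ℝ} {Θ : Set (Fin n → ℝ)} {f : (Fin n → ℝ) → Q → ℝ} {N : ℕ}
    {x : Fin (N + 1) → Q} (hx : ∃! θ, IsOptimal c Θ f x θ) (j : Fin (N + 1))
    (hj : ∃! θ, IsOptimal c Θ f (fun i => x (j.succAbove i)) θ) :
    IsSupport c Θ f x j ↔ 0 < f (scenarioSol c Θ f fun i => x (j.succAbove i)) (x j) := by
  have hset : feasibleSet Θ f x {j}ᶜ = feasibleSet Θ f (fun i => x (j.succAbove i)) univ := by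
    ext θ
    simp only [feasibleSet, mem_ofPred_eq, mem_univ, true_imp_iff, mem_compl_iff, mem_singleton_iff]
    refine and_congr_right fun _ => ⟨fun h i => h _ (Fin.succAbove_ne j i), fun h i hi => ?_⟩
    obtain ⟨k, rfl⟩ := Fin.exists_succAbove_eq hi
    exact h k
  have hval : ∀ {m : ℕ} {y : Fin m → Q} {θ}, IsOptimal c Θ f y θ →
      sInf ((fun θ => c ⬝ᵥ θ) '' feasibleSet Θ f y univ) = c ⬝ᵥ θ := fun {m y θ} h =>
    IsLeast.csInf_eq ⟨mem_image_of_mem _ h.1, by rintro _ ⟨θ', hθ', rfl⟩; exact h.2 θ' hθ'⟩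
  obtain ⟨h1, h2⟩ := scenarioSol_spec hx
  obtain ⟨h3, h4⟩ := scenarioSol_spec hj
  set θ := scenarioSol c Θ f x
  set θ' := scenarioSol c Θ f fun i => x (j.succAbove i)
  have hθ : θ ∈ feasibleSet Θ f (fun i => x (j.succAbove i)) univ :=
    ⟨h1.1.1, fun i _ => h1.1.2 _ (mem_univ _)⟩
  rw [IsSupport, optValue, optValue, hset, hval h1, hval h3]
  constructor
  · intro hlt
    by_contra! hle
    refine absurd (h1.2 θ' ⟨h3.1.1, fun i _ => ?_⟩) (not_le.2 hlt)
    rcases eq_or_ne i j with rfl | hi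
    · exact hle
    · obtain ⟨k, rfl⟩ := Fin.exists_succAbove_eq hi
      exact h3.1.2 k (mem_univ _)
  · intro hpos
    refine lt_of_le_of_ne (h3.2 θ hθ) fun heq => ?_
    have : θ = θ' := h4 θ ⟨hθ, fun p hp => heq ▸ h3.2 p hp⟩
    exact absurd (h1.1.2 j (mem_univ _)) (not_le.2 (this ▸ hpos))

variable [MeasurableSpace Q]

lemma violation_mem_Icc (P : Measure Q) [IsProbabilityMeasure P] (f : (Fin n → ℝ) → Q → ℝ)
    (θ : Fin n → ℝ) : violation P f θ ∈ Icc (0 : ℝ) 1 :=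
  ⟨measureReal_nonneg, measureReal_le_one⟩

/-- The law of the violation probability of the scenario solution. -/
noncomputable def violationLaw (P : Measure Q) (c : Fin n → ℝ) (Θ : Set (Fin n → ℝ))
    (f : (Fin n → ℝ) → Q → ℝ) (N : ℕ) : Measure ℝ :=
  (Measure.pi fun _ : Fin N => P).map fun ω => violation P f (scenarioSol c Θ f ω)

lemma measureReal_rvo (P : Measure Q) [IsProbabilityMeasure P] {f : (Fin n → ℝ) → Q → ℝ}
    (hfm : ∀ θ, Measurable (f θ)) (No : ℕ) {ε' : ℝ} (hε' : 0 ≤ ε') (θ : Fin n → ℝ) :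
    (Measure.pi fun _ : Fin No => P).real {ωo | rvo f ε' ωo θ = true} =
      binomCDF ⌊ε' * No⌋₊ No (violation P f θ) := by
  classical
  rw [violation, ← measureReal_card_le P (measurableSet_lt measurable_const (hfm θ))]
  congr 1; ext ωo
  simp only [rvo, mem_ofPred_eq, decide_eq_true_eq, Finset.sum_boole]
  rw [Nat.le_floor_iff (by positivity)]

lemma aemeasurable_violation_scenarioSol {P : Measure Q} [IsProbabilityMeasure P] {c : Fin n → ℝ}
    {Θ : Set (Fin n → ℝ)} (hΘc : IsCompact Θ) {f : (Fin n → ℝ) → Q → ℝ}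
    (hfc : ∀ q, Continuous fun θ => f θ q) (hfm : ∀ θ, Measurable (f θ)) {N : ℕ}
    (hsolv : UniquelySolvable P c Θ f N) :
    AEMeasurable (fun ω => violation P f (scenarioSol c Θ f ω)) (Measure.pi fun _ : Fin N => P) :=
  (measurable_violation P hfc hfm).comp_aemeasurable (aemeasurable_scenarioSol hΘc hfc hfm hsolv)

/-- Fubini over the design samples: conditionally on them, the oracle's count is binomial with
success probability `V(θ*)`. -/
lemma stageProb_trueEvent_inter {P : Measure Q} [IsProbabilityMeasure P] {c : Fin n → ℝ}
    {Θ : Set (Fin n → ℝ)} (hΘc : IsCompact Θ) {f : (Fin n → ℝ) → Q → ℝ}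
    (hfc : ∀ q, Continuous fun θ => f θ q) (hfm : ∀ θ, Measurable (f θ)) {N : ℕ}
    (hsolv : UniquelySolvable P c Θ f N) (No : ℕ) {ε' : ℝ} (hε' : 0 ≤ ε') {D : Set ℝ}
    (hD : MeasurableSet D) :
    (stageProb P N No).real
        (TrueEvent c Θ f N No ε' ∩ {s | violation P f (scenarioSol c Θ f s.1) ∈ D}) =
      ∫ v, D.indicator (binomCDF ⌊ε' * No⌋₊ No) v ∂(violationLaw P c Θ f N) := by
  classical
  have hs := aemeasurable_scenarioSol hΘc hfc hfm hsolv
  -- `scenarioSol` is only almost everywhere measurable, so a measurable version replaces it.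
  set θ := hs.mk
  have hθm : Measurable θ := hs.measurable_mk
  have hVm : Measurable (violation P f) := measurable_violation P hfc hfm
  have hrvo : MeasurableSet {p : (Fin N → Q) × (Fin No → Q) | rvo f ε' p.2 (θ p.1) = true} := by
    simp only [rvo, decide_eq_true_eq]
    refine measurableSet_le (Finset.measurable_sum _ fun i _ => Measurable.ite ?_ measurable_const
      measurable_const) measurable_const
    exact ((hθm.comp measurable_fst).prodMk ((measurable_pi_apply i).comp measurable_snd))
      (measurableSet_violated hfc hfm)
  have hDm : MeasurableSet {ω | violation P f (θ ω) ∈ D} := (hVm.comp hθm) hD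
  set W : Set ((Fin N → Q) × (Fin No → Q)) :=
    {p | rvo f ε' p.2 (θ p.1) = true} ∩ {p | violation P f (θ p.1) ∈ D}
  have hW : MeasurableSet W := hrvo.inter (measurable_fst hDm)
  have hae : (TrueEvent c Θ f N No ε' ∩ {s | violation P f (scenarioSol c Θ f s.1) ∈ D} :
      Set ((Fin N → Q) × (Fin No → Q))) =ᵐ[stageProb P N No] W := by
    have := (measurePreserving_fst (μ := Measure.pi fun _ : Fin N => P)
      (ν := Measure.pi fun _ : Fin No => P)).quasiMeasurePreserving.ae hs.ae_eq_mk
    refine eventuallyEq_set.2 ?_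
    filter_upwards [this] with p hp
    simp only [W, TrueEvent, mem_inter_iff, mem_ofPred_eq]
    rw [hp]
  rw [measureReal_congr hae, violationLaw, integral_map
    (aemeasurable_violation_scenarioSol hΘc hfc hfm hsolv)
    ((measurable_binomCDF _ _).indicator hD).aestronglyMeasurable,
    integral_congr_ae (g := fun ω => D.indicator (binomCDF ⌊ε' * No⌋₊ No) (violation P f (θ ω)))
      (hs.ae_eq_mk.mono fun ω hω => by simp only [hω]; rfl),
    integral_eq_lintegral_of_nonneg_ae (Eventually.of_forall fun ω =>
      indicator_apply_nonneg fun _ => (binomCDF_nonneg _ _ (violation_mem_Icc P f (θ ω))))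
      (((measurable_binomCDF _ _).indicator hD).comp (hVm.comp hθm)).aestronglyMeasurable,
    Measure.real, stageProb, Measure.prod_apply hW]
  congr 1
  refine lintegral_congr fun ω => ?_
  by_cases hω : violation P f (θ ω) ∈ D
  · rw [indicator_of_mem hω, ← measureReal_rvo P hfm No hε', ofReal_measureReal]
    congr 1; ext z; simp [W, hω]
  · have : Prod.mk ω ⁻¹' W = ∅ := by ext z; simp [W, hω]
    rw [indicator_of_notMem hω, ENNReal.ofReal_zero, this, measure_empty]

/-- For fully supported problems the mean violation probability is `n / (N + 1)`. -/
lemma integral_violationLaw {P : Measure Q} [IsProbabilityMeasure P] {c : Fin n → ℝ}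
    {Θ : Set (Fin n → ℝ)} (hΘc : IsCompact Θ) {f : (Fin n → ℝ) → Q → ℝ}
    (hfc : ∀ q, Continuous fun θ => f θ q) (hfm : ∀ θ, Measurable (f θ)) {N : ℕ}
    (hsolv : UniquelySolvable P c Θ f N) (hsolv' : UniquelySolvable P c Θ f (N + 1))
    (hfull : FullySupported P c Θ f (N + 1)) :
    ∫ v, v ∂(violationLaw P c Θ f N) = (n : ℝ) / (N + 1) := by
  classical
  have hs := aemeasurable_scenarioSol hΘc hfc hfm hsolv
  set θ := hs.mk
  have hθm : Measurable θ := hs.measurable_mk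
  have hVm : Measurable (violation P f) := measurable_violation P hfc hfm
  set W : Set (Q × (Fin N → Q)) := {p | 0 < f (θ p.2) p.1}
  have hW : MeasurableSet W :=
    ((hθm.comp measurable_snd).prodMk measurable_fst) (measurableSet_violated hfc hfm)
  have mp : ∀ j : Fin (N + 1), MeasurePreserving
      (fun x : Fin (N + 1) → Q => (x j, fun i => x (j.succAbove i))) (Measure.pi fun _ => P)
      (P.prod (Measure.pi fun _ : Fin N => P)) := fun j =>
    measurePreserving_piFinSuccAbove (fun _ : Fin (N + 1) => P) j
  set M : ENNReal := ∫⁻ ω, P {q | 0 < f (θ ω) q} ∂(Measure.pi fun _ : Fin N => P) with hM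
  set E : Fin (N + 1) → Set (Fin (N + 1) → Q) := fun j =>
    (fun x : Fin (N + 1) → Q => (x j, fun i => x (j.succAbove i))) ⁻¹' W
  have hE : ∀ j, Measure.pi (fun _ => P) (E j) = M := fun j => by
    rw [(mp j).measure_preimage hW.nullMeasurableSet, Measure.prod_apply_symm hW]
    rfl
  -- Leave-one-out: `E j` says that sample `j` violates the solution of the others. Almost surely
  -- exactly `n` of these events occur, all with probability E V.
  have hsum : ∫⁻ x, ∑ j, (E j).indicator 1 x ∂(Measure.pi fun _ : Fin (N + 1) => P) = n := by
    rw [lintegral_congr_ae (g := fun _ => (n : ENNReal))]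
    · simp
    · have h1 : ∀ᵐ x ∂(Measure.pi fun _ : Fin (N + 1) => P), ∀ j : Fin (N + 1),
          (∃! θ, IsOptimal c Θ f (fun i => x (j.succAbove i)) θ) ∧
          scenarioSol c Θ f (fun i => x (j.succAbove i)) = θ fun i => x (j.succAbove i) :=
        ae_all_iff.2 fun j => (measurePreserving_snd.comp (mp j)).quasiMeasurePreserving.ae
          (hsolv.and hs.ae_eq_mk)
      filter_upwards [h1, hsolv', hfull] with x hx1 hx2 hx3
      have : {j | IsSupport c Θ f x j} = ↑(Finset.univ.filter fun j => x ∈ E j) := by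
        ext j
        simp only [mem_ofPred_eq, Finset.coe_filter, Finset.mem_univ, true_and]
        rw [isSupport_iff hx2 j (hx1 j).1, (hx1 j).2]
        rfl
      rw [this, ncard_coe_finset] at hx3
      simp only [indicator_apply, Pi.one_apply]
      rw [Finset.sum_boole, hx3]
  rw [lintegral_finsetSum _ fun j _ => measurable_one.indicator ((mp j).measurable hW)] at hsum
  simp_rw [lintegral_indicator_one ((mp _).measurable hW)] at hsum
  have hsum' : ((N : ENNReal) + 1) * M = n := by
    rw [← hsum, Finset.sum_congr rfl fun j _ => hE j]
    simp
  have hMreal : ∫ v, v ∂(violationLaw P c Θ f N) = M.toReal := by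
    rw [violationLaw, integral_map (aemeasurable_violation_scenarioSol hΘc hfc hfm hsolv)
      (f := fun v : ℝ => v) aestronglyMeasurable_id,
      integral_congr_ae (g := fun ω => violation P f (θ ω))
        (hs.ae_eq_mk.mono fun ω hω => by simp only [hω]; rfl),
      integral_eq_lintegral_of_nonneg_ae (Eventually.of_forall fun ω => (violation_mem_Icc P f (θ ω)).1)
      (hVm.comp hθm).aestronglyMeasurable]
    congr 1
    exact lintegral_congr fun ω => ofReal_measureReal
  have := congrArg ENNReal.toReal hsum'
  rw [ENNReal.toReal_mul] at this
  rw [hMreal, eq_div_iff (by positivity), mul_comm]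
  simpa [ENNReal.toReal_add] using this

lemma integral_id_betaMeasure {N : ℕ} (hn : 1 ≤ n) (hN : n ≤ N) :
    ∫ v, v ∂(betaMeasure n ((N : ℝ) + 1 - n)) = (n : ℝ) / (N + 1) := by
  have ha : (0 : ℝ) < n := by exact_mod_cast hn
  have hb : (0 : ℝ) < (N : ℝ) + 1 - n := by
    have : (n : ℝ) ≤ N := by exact_mod_cast hN
    linarith
  have h := integral_pow_betaMeasure ha hb 1
  simp only [pow_one, Nat.cast_one] at h
  rw [h, beta, beta, show (n : ℝ) + 1 + (N + 1 - n) = (N + 1) + 1 by ring,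
    show (n : ℝ) + (N + 1 - n) = N + 1 by ring, Real.Gamma_add_one ha.ne',
    Real.Gamma_add_one (s := (N : ℝ) + 1) (by positivity)]
  have := (Real.Gamma_pos_of_pos ha).ne'
  have := (Real.Gamma_pos_of_pos hb).ne'
  have := (Real.Gamma_pos_of_pos (show (0 : ℝ) < N + 1 by positivity)).ne'
  field_simp

lemma violationLaw_Iic_ge (hn : 1 ≤ n) (P : Measure Q) [IsProbabilityMeasure P]
    {c : Fin n → ℝ} {Θ : Set (Fin n → ℝ)} (hΘ : Convex ℝ Θ) (hΘc : IsCompact Θ)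
    {f : (Fin n → ℝ) → Q → ℝ} (hf : ∀ q, ConvexOn ℝ univ fun θ => f θ q)
    (hfc : ∀ q, Continuous fun θ => f θ q)
    (hfm : ∀ θ, Measurable (f θ)) {N : ℕ} (hN : n ≤ N)
    (hsolv : ∀ m, N ≤ m → UniquelySolvable P c Θ f m) (t : ℝ) :
    betaMeasure n ((N : ℝ) + 1 - n) (Iic t) ≤ violationLaw P c Θ f N (Iic t) := by
  have ha : (0 : ℝ) < n := by exact_mod_cast hn
  have hb : (0 : ℝ) < (N : ℝ) + 1 - n := by
    have : (n : ℝ) ≤ N := by exact_mod_cast hN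
    linarith
  have := isProbabilityMeasureBeta ha hb
  have := isProbabilityMeasureBeta hb ha
  have hV := aemeasurable_violation_scenarioSol hΘc hfc hfm (hsolv N le_rfl)
  have : IsProbabilityMeasure (violationLaw P c Θ f N) := Measure.isProbabilityMeasure_map hV
  -- The reflection formula for `Fbeta` is used only for `t` in [0, 1]; outside, the bound is
  -- trivial.
  rcases lt_or_ge t 0 with ht0 | ht0
  · have : betaMeasure n ((N : ℝ) + 1 - n) (Iic t) = 0 := by
      refine measure_mono_null (fun x (hx : x ≤ t) => ?_) (ae_iff.1 (betaMeasure_ae_mem_Icc _ _))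
      exact fun hx' : x ∈ Icc (0 : ℝ) 1 => by linarith [hx'.1]
    rw [this]; exact zero_le
  rcases lt_or_ge 1 t with ht1 | ht1
  · have : violationLaw P c Θ f N (Iic t) = 1 := by
      rw [violationLaw, Measure.map_apply_of_aemeasurable hV measurableSet_Iic]
      convert! measure_univ
      · exact eq_univ_of_forall fun ω => measureReal_le_one.trans ht1.le
      · infer_instance
    rw [this]; exact prob_le_one
  have h := violation_tail_le hn P hΘ hΘc hf hfc hfm hN hsolv t
  have h1 : violationLaw P c Θ f N (Ioi t) ≤ betaMeasure ((N : ℝ) + 1 - n) n (Iic (1 - t)) := by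
    rw [violationLaw, Measure.map_apply_of_aemeasurable hV measurableSet_Ioi]
    exact h.trans (measure_mono Iio_subset_Iic_self)
  have h2 := ENNReal.toReal_mono (measure_ne_top _ _) h1
  rw [← compl_Iic] at h2
  change (violationLaw P c Θ f N).real (Iic t)ᶜ ≤ (betaMeasure ((N : ℝ) + 1 - n) n).real _ at h2
  rw [probReal_compl_eq_one_sub measurableSet_Iic, betaMeasure_Iic hb ha (by linarith),
    Fbeta_one_sub hb ha, ← betaMeasure_Iic ha hb ht0] at h2
  rw [← ENNReal.toReal_le_toReal (measure_ne_top _ _) (measure_ne_top _ _)]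
  change (betaMeasure n ((N : ℝ) + 1 - n)).real _ ≤ (violationLaw P c Θ f N).real _
  linarith

lemma integral_indicator_binomCDF_le {ρ κ : Measure ℝ} [IsProbabilityMeasure ρ]
    [IsProbabilityMeasure κ] (hρ : ∀ᵐ x ∂ρ, x ∈ Icc (0 : ℝ) 1) (hκ : ∀ᵐ x ∂κ, x ∈ Icc (0 : ℝ) 1)
    (h : ∀ t, κ (Iic t) ≤ ρ (Iic t)) (k M : ℕ) (ε : ℝ) :
    ∫ v, (Iic ε).indicator (binomCDF k M) v ∂κ ≤ ∫ v, (Iic ε).indicator (binomCDF k M) v ∂ρ := by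
  -- The polynomial `binomCDF` is monotone only on [0, 1]; clamping gives a function antitone on all
  -- of ℝ.
  set p : ℝ → ℝ := fun v => max 0 (min v 1)
  have hp : ∀ v, p v ∈ Icc (0 : ℝ) 1 := fun v =>
    ⟨le_max_left _ _, max_le zero_le_one (min_le_right _ _)⟩
  have hpv : ∀ v ∈ Icc (0 : ℝ) 1, p v = v := fun v hv => by
    simp only [p]; rw [min_eq_left hv.2, max_eq_right hv.1]
  set g : ℝ → ℝ := (Iic ε).indicator fun v => binomCDF k M (p v)
  have hg : Antitone g := by
    intro u v huv
    by_cases hv : v ∈ Iic ε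
    · have hu : u ∈ Iic ε := huv.trans hv
      simp only [g, indicator_of_mem hv, indicator_of_mem hu]
      exact binomCDF_antitoneOn k M (hp u) (hp v) (max_le_max le_rfl (min_le_min huv le_rfl))
    · simp only [g, indicator_of_notMem hv]
      exact indicator_apply_nonneg fun _ => (binomCDF_nonneg k M (hp u))
  have hcongr : ∀ τ : Measure ℝ, (∀ᵐ x ∂τ, x ∈ Icc (0 : ℝ) 1) →
      ∫ v, (Iic ε).indicator (binomCDF k M) v ∂τ = ∫ v, g v ∂τ := fun τ hτ =>
    integral_congr_ae (hτ.mono fun v hv => by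
      simp only [g, indicator_apply, hpv v hv])
  rw [hcongr κ hκ, hcongr ρ hρ]
  refine integral_antitone_le h hg (K := 1) (fun v => indicator_apply_nonneg fun _ => (binomCDF_nonneg k M (hp v)))
    fun v => ?_
  by_cases hv : v ∈ Iic ε
  · simp only [g, indicator_of_mem hv]; exact binomCDF_le_one k M (hp v)
  · simp only [g, indicator_of_notMem hv]; exact zero_le_one

lemma integral_indicator_Ioi_binomCDF_le {ρ : Measure ℝ} [IsProbabilityMeasure ρ]
    (hρ : ∀ᵐ x ∂ρ, x ∈ Icc (0 : ℝ) 1) (k M : ℕ) {ε : ℝ} (hε : ε ∈ Icc (0 : ℝ) 1) :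
    ∫ v, (Ioi ε).indicator (binomCDF k M) v ∂ρ ≤ binomCDF k M ε * ρ.real (Ioi ε) := by
  rw [mul_comm, ← smul_eq_mul, ← integral_indicator_const _ measurableSet_Ioi]
  refine integral_mono_of_nonneg (hρ.mono fun v hv => indicator_apply_nonneg fun _ => (binomCDF_nonneg k M hv))
    ((integrable_const _).indicator measurableSet_Ioi) (hρ.mono fun v hv => ?_)
  by_cases h : v ∈ Ioi ε
  · simp only [indicator_of_mem h]
    exact binomCDF_antitoneOn k M hε hv (le_of_lt h)
  · simp only [indicator_of_notMem h]; exact le_rfl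

/-- Rounding `ε' No` down raises the first beta parameter and lowers the second. `ε' < 1` keeps the
first one positive. -/
lemma binomCDF_floor_le {No : ℕ} (hNo : 1 ≤ No) {ε ε' : ℝ} (hε : ε ∈ Icc (0 : ℝ) 1)
    (hε' : 0 ≤ ε') (hε'1 : ε' < 1) :
    binomCDF ⌊ε' * No⌋₊ No ε ≤ Fbeta ((1 - ε') * No) (ε' * No + 1) (1 - ε) := by
  have hNo' : (0 : ℝ) < No := by exact_mod_cast hNo
  have h0 : 0 ≤ ε' * No := by positivity
  have h1 : ε' * No < No := mul_lt_of_lt_one_left hNo' hε'1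
  have hfl := Nat.floor_le h0
  have hk : ⌊ε' * No⌋₊ < No := (Nat.floor_lt h0).2 h1
  rw [binomCDF_eq_Fbeta hk hε.1 hε.2]
  exact Fbeta_param_mono (by nlinarith) (by positivity) (by linarith) (by linarith)
    (by linarith [hε.2]) (by linarith [hε.1])

end Iteration

end RSD

/-! ### Assembly of the theorem. -/

open RSD ProbabilityTheory Set Filter

theorem mainTheorem2 {n : ℕ} (hn : 1 ≤ n) {Q : Type*} [MeasurableSpace Q]
    (P : Measure Q) [IsProbabilityMeasure P]
    (c : Fin n → ℝ) (Θ : Set (Fin n → ℝ)) (hΘconv : Convex ℝ Θ) (hΘcomp : IsCompact Θ)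
    (f : (Fin n → ℝ) → Q → ℝ)
    (hfconv : ∀ q, ConvexOn ℝ Set.univ (fun θ => f θ q))
    (hfmeas : ∀ θ, Measurable (f θ))
    (N No : ℕ) (hN : n ≤ N) (ε ε' : ℝ) (hε : ε ∈ Set.Icc (0 : ℝ) 1)
    (hε' : ε' ∈ Set.Icc (0 : ℝ) 1)
    (hsolv : ∀ m, N ≤ m → RSD.UniquelySolvable P c Θ f m) :
    1 - RSD.H1 n N No ε' ≤ (RSD.stageProb P N No).real (RSD.TrueEvent c Θ f N No ε') ∧
    1 - RSD.H n N No ε ε' ≤ (RSD.stageProb P N No).real (RSD.GoodTrue P c Θ f N No ε ε') ∧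
    (1 - RSD.betaBar n N No ε ε') * (1 - RSD.H1 n N No ε') ≤ 1 - RSD.H n N No ε ε' ∧
    (1 ≤ No → ε' < 1 →
      (RSD.stageProb P N No).real (RSD.BadTrue P c Θ f N No ε ε') ≤
        RSD.Fbeta ((1 - ε') * (No : ℝ)) (ε' * (No : ℝ) + 1) (1 - ε) * RSD.betaTail n N ε) ∧
    ((∀ m, N ≤ m → RSD.FullySupported P c Θ f m) →
      (RSD.stageProb P N No).real (RSD.TrueEvent c Θ f N No ε') = 1 - RSD.H1 n N No ε' ∧
      (RSD.stageProb P N No).real (RSD.GoodTrue P c Θ f N No ε ε') = 1 - RSD.H n N No ε ε' ∧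
      (RSD.stageProb P N No).real (RSD.BadTrue P c Θ f N No ε ε') =
        RSD.H n N No ε ε' - RSD.H1 n N No ε' ∧
      RSD.H n N No ε ε' - RSD.H1 n N No ε' ≤
        RSD.betaBar n N No ε ε' * (1 - RSD.H1 n N No ε')) := by
  -- A finite convex function on all of ℝⁿ is continuous.
  have hfc : ∀ q, Continuous fun θ => f θ q := fun q =>
    (hfconv q).locallyLipschitz.continuous
  have hs := hsolv N le_rfl
  have ha : (0 : ℝ) < n := by exact_mod_cast hn
  have hb : (0 : ℝ) < (N : ℝ) + 1 - n := by
    have : (n : ℝ) ≤ N := by exact_mod_cast hN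
    linarith
  have hV := aemeasurable_violation_scenarioSol hΘcomp hfc hfmeas hs
  have : IsProbabilityMeasure (violationLaw P c Θ f N) := Measure.isProbabilityMeasure_map hV
  have := isProbabilityMeasureBeta ha hb
  have hρ : ∀ᵐ v ∂(violationLaw P c Θ f N), v ∈ Icc (0 : ℝ) 1 :=
    (ae_map_iff hV measurableSet_Icc).2
      (Eventually.of_forall fun ω => violation_mem_Icc P f _)
  have hκ := betaMeasure_ae_mem_Icc (n : ℝ) ((N : ℝ) + 1 - n)
  have hdom := violationLaw_Iic_ge hn P hΘconv hΘcomp hfconv hfc hfmeas hN hsolv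
  have hgood : ∀ η, (stageProb P N No).real (GoodTrue P c Θ f N No η ε') =
      ∫ v, (Iic η).indicator (binomCDF ⌊ε' * No⌋₊ No) v ∂(violationLaw P c Θ f N) := fun η =>
    stageProb_trueEvent_inter hΘcomp hfc hfmeas hs No hε'.1 measurableSet_Iic
  have hbad : (stageProb P N No).real (BadTrue P c Θ f N No ε ε') =
      ∫ v, (Ioi ε).indicator (binomCDF ⌊ε' * No⌋₊ No) v ∂(violationLaw P c Θ f N) :=
    stageProb_trueEvent_inter hΘcomp hfc hfmeas hs No hε'.1 measurableSet_Ioi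
  -- A violation probability never exceeds 1, so `True` is `GoodTrue` at level 1.
  have htrue : TrueEvent c Θ f N No ε' = GoodTrue P c Θ f N No 1 ε' :=
    (inter_eq_left.2 fun s _ => (violation_mem_Icc P f _).2).symm
  have hbar := one_sub_betaBar_mul_le hn hN No hε hε'
  refine ⟨?_, ?_, hbar, fun hNo hε1 => ?_, fun hfull => ?_⟩
  · rw [htrue, hgood, ← H_one hn hN No hε', one_sub_H_eq hn hN No zero_le_one hε']
    exact integral_indicator_binomCDF_le hρ hκ hdom _ _ _
  · rw [hgood, one_sub_H_eq hn hN No hε.1 hε']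
    exact integral_indicator_binomCDF_le hρ hκ hdom _ _ _
  · rw [hbad]
    refine (integral_indicator_Ioi_binomCDF_le hρ _ _ hε).trans ?_
    have h1 : (violationLaw P c Θ f N).real (Ioi ε) ≤ betaTail n N ε := by
      rw [betaTail_eq hn hN hε, ← betaMeasure_Iic ha hb hε.1, ← compl_Iic,
        probReal_compl_eq_one_sub measurableSet_Iic]
      exact sub_le_sub_left (ENNReal.toReal_mono (measure_ne_top _ _) (hdom ε)) _
    have h2 := binomCDF_floor_le hNo hε hε'.1 hε1
    exact mul_le_mul h2 h1 measureReal_nonneg ((binomCDF_nonneg _ _ hε).trans h2)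
  -- Full support is needed only with N+1 scenarios, to compute the mean.
  · have hlaw : violationLaw P c Θ f N = betaMeasure n ((N : ℝ) + 1 - n) := by
      refine eq_of_dominance_of_mean hρ hκ hdom ?_
      rw [integral_id_betaMeasure hn hN, integral_violationLaw hΘcomp hfc hfmeas hs
        (hsolv _ (Nat.le_succ N)) (hfull _ (Nat.le_succ N))]
    have hG : ∀ η, 0 ≤ η →
        (stageProb P N No).real (GoodTrue P c Θ f N No η ε') = 1 - H n N No η ε' := fun η hη => by
      rw [hgood, hlaw, one_sub_H_eq hn hN No hη hε']
    have hT : (stageProb P N No).real (TrueEvent c Θ f N No ε') = 1 - H1 n N No ε' := by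
      rw [htrue, hG 1 zero_le_one, H_one hn hN No hε']
    refine ⟨hT, hG ε hε.1, ?_, by linarith⟩
    have hI : ∀ D : Set ℝ, MeasurableSet D →
        Integrable (D.indicator (binomCDF ⌊ε' * No⌋₊ No)) (violationLaw P c Θ f N) := fun D hD =>
      (Integrable.of_bound (measurable_binomCDF _ _).aestronglyMeasurable 1 (hρ.mono fun v hv => by
        rw [Real.norm_of_nonneg (binomCDF_nonneg _ _ hv)]
        exact binomCDF_le_one _ _ hv)).indicator hD
    have hsplit : (stageProb P N No).real (TrueEvent c Θ f N No ε') =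
        (stageProb P N No).real (GoodTrue P c Θ f N No ε ε') +
          (stageProb P N No).real (BadTrue P c Θ f N No ε ε') := by
      rw [htrue, hgood, hgood, hbad, ← integral_add (hI _ measurableSet_Iic) (hI _ measurableSet_Ioi)]
      refine integral_congr_ae (hρ.mono fun v hv => ?_)
      by_cases h : v ≤ ε
      · simp [h, hv.2]
      · simp [h, hv.2, lt_of_not_ge h]
    rw [hT, hG ε hε.1] at hsplit
    linarith
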